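/- Let $T$ be a complete first-order theory, possibly many-sorted, in a countable language (countably many sorts and symbols), and let $\mathfrak C\models T$ be a monster model: $\mathfrak C$ is $\kappa$-saturated and strongly $\kappa$-homogeneous for some cardinal $\kappa>2^{\aleph_0}$. Let $P$ be a product of countably many sorts of $\mathfrak C$ (with repetitions allowed). For $a,b\in P$ write $a\equiv b$ if $\operatorname{tp}(a/\emptyset)=\operatorname{tp}(b/\emptyset)$. For a set of parameters $A$, let $S_P(A)$ be the space of complete types over $A$ of elements of $P$, with the usual topology. For an $\operatorname{Aut}(\mathfrak C)$-invariant equivalence relation $R$ on $P$ we use the following terms. - $R$ is bounded if it has fewer than $\kappa$ classes. - $R$ is definable if $\{(a,b): a\mathrel R b\}$ is defined by a formula without parameters. It is type-definable if this set is defined by a set of formulas without parameters. It is $F_\sigma$ if $\{\operatorname{tp}(a,b/\emptyset): a\mathrel R b\}$ is an $F_\sigma$ subset of $S_{P^2}(\emptyset)$. - For a countable $M\preceq\mathfrak C$, let $R^M$ be the relation on $S_P(M)$ given by: $p\mathrel{R^M}q$ iff $a\mathrel R b$ for some $a\models p$, $b\models q$. A bounded $R$ is smooth if countable models $M\preceq\mathfrak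 C$ exist and for each of them there are a Polish space $Z$ and a Borel map $f:S_P(M)\to Z$ with $p\mathrel{R^M}q\iff f(p)=f(q)$ for all $p,q\in S_P(M)$. - $R$ is orbital on types if $R\subseteq{\equiv}$ and for every $p\in S_P(\emptyset)$ there is a group $\Gamma\le\operatorname{Aut}(\mathfrak C)$ that preserves setwise each class of the restriction of $R$ to the set $p(\mathfrak C)$ of realisations of $p$, and acts transitively on each of these classes. Let $E$ be a definable bounded equivalence relation on $P$, and let $p_0\in S_P(\emptyset)$ be a non-isolated complete type such that $p_0(\mathfrak C)$ is not contained in a single $E$-class. Then $E$ has only finitely many classes, and the relation $$E'(x,y)\iff\bigl(E(x,y)\lor x\not\models p_0\bigr)\land x\equiv y$$ is a bounded invariant equivalence relation on $P$ which is $F_\sigma$ and smooth, but not type-definable. Furthermore, if $E\cap{\equiv}$ is orbital on types, then so is $E'$. -/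

import Mathlib

open Cardinal Set

universe u v w x y

/-! ### Many-sorted first-order logic -/

/-- A many-sorted first-order language: sorts, function symbols with a list of argument sorts and a
value sort (constants have the empty list), and relation symbols with a list of argument sorts. -/
structure SortedLanguage where
  Sorts : Type u
  Func : List Sorts → Sorts → Type v
  Rel : List Sorts → Type v

namespace SortedLanguage

/-- The language is countable: countably many sorts, function symbols and relation symbols. -/
def IsCountable (L : SortedLanguage.{u, v}) : Prop :=
  Countable L.Sorts ∧ Countable (Σ (d : List L.Sorts) (s : L.Sorts), L.Func d s) ∧
    Countable (Σ d : List L.Sorts, L.Rel d)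

/-- `Bound l s` is the set of those variables among a list of variables whose sorts are listed by
`l` that have sort `s`; they serve as the bound variables (de Bruijn style). -/
inductive Bound {S : Type u} : List S → S → Type u
  | zero {s : S} {l : List S} : Bound (s :: l) s
  | succ {s t : S} {l : List S} (i : Bound l s) : Bound (t :: l) s

/-- A tuple of variables of `L` is a family `X`, where `X s` is the set of indices of the variables
of sort `s`. The concatenation of two tuples of variables: -/
abbrev Concat {S : Type u} (X : S → Type x) (Y : S → Type y) : S → Type (max x y) :=
  fun s => X s ⊕ Y s

/-- The tuple consisting of a single variable, of sort `s`. -/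
abbrev Single {S : Type u} (s : S) : S → Type := fun t => PLift (s = t)

/-- Terms with variables in `X`, by sort of the value. -/
inductive Term (L : SortedLanguage.{u, v}) (X : L.Sorts → Type x) : L.Sorts → Type (max u v x)
  | var {s : L.Sorts} (i : X s) : Term L X s
  | app {d : List L.Sorts} {s : L.Sorts} (f : L.Func d s)
      (ts : ∀ i : Fin d.length, Term L X (d.get i)) : Term L X s

/-- First-order formulas with free variables in `X` together with variables in `Bound l`. -/
inductive BoundedFormula (L : SortedLanguage.{u, v}) (X : L.Sorts → Type x) :
    List L.Sorts → Type (max u v x)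
  | falsum {l : List L.Sorts} : BoundedFormula L X l
  | equal {l : List L.Sorts} {s : L.Sorts} (t₁ t₂ : L.Term (Concat X (Bound l)) s) :
      BoundedFormula L X l
  | rel {l d : List L.Sorts} (R : L.Rel d)
      (ts : ∀ i : Fin d.length, L.Term (Concat X (Bound l)) (d.get i)) : BoundedFormula L X l
  | imp {l : List L.Sorts} (φ ψ : BoundedFormula L X l) : BoundedFormula L X l
  | all {l : List L.Sorts} (s : L.Sorts) (φ : BoundedFormula L X (s :: l)) : BoundedFormula L X l

/-- First-order formulas all of whose free variables are in `X`. -/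
abbrev Formula (L : SortedLanguage.{u, v}) (X : L.Sorts → Type x) : Type (max u v x) :=
  L.BoundedFormula X []

/-- Structures for a many-sorted language. -/
structure Str (L : SortedLanguage.{u, v}) where
  carrier : L.Sorts → Type w
  funMap {d : List L.Sorts} {s : L.Sorts} (f : L.Func d s)
    (a : ∀ i : Fin d.length, carrier (d.get i)) : carrier s
  relMap {d : List L.Sorts} (R : L.Rel d) (a : ∀ i : Fin d.length, carrier (d.get i)) : Prop

namespace Str

variable {L : SortedLanguage.{u, v}} (M : Str.{u, v, w} L)

/-- The product of sorts of `M` consisting of the tuples of values for the variables in `X`. -/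
abbrev Tuple (X : L.Sorts → Type x) : Type (max u w x) := ∀ s : L.Sorts, X s → M.carrier s

/-- The concatenation of two tuples. -/
def concat {X : L.Sorts → Type x} {Y : L.Sorts → Type y} (a : M.Tuple X) (b : M.Tuple Y) :
    M.Tuple (Concat X Y) :=
  fun s => Sum.elim (a s) (b s)

/-- Values of the bound variables: no value, and one more value at the front. -/
def boundNil : M.Tuple (Bound (S := L.Sorts) []) := fun _ i => nomatch i

def boundCons {l : List L.Sorts} {t : L.Sorts} (e : M.carrier t) (b : M.Tuple (Bound l)) :
    M.Tuple (Bound (t :: l))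
  | _, .zero => e
  | _, .succ i => b _ i

/-- The value of a term. -/
def eval {X : L.Sorts → Type x} (a : M.Tuple X) : {s : L.Sorts} → L.Term X s → M.carrier s
  | _, .var i => a _ i
  | _, .app f ts => M.funMap f fun i => eval a (ts i)

/-- Truth of a formula (with bound variables allowed to be free) in `M`. -/
def BRealize {X : L.Sorts → Type x} (a : M.Tuple X) :
    {l : List L.Sorts} → L.BoundedFormula X l → M.Tuple (Bound l) → Prop
  | _, .falsum, _ => False
  | _, .equal t₁ t₂, b => M.eval (M.concat a b) t₁ = M.eval (M.concat a b) t₂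
  | _, .rel R ts, b => M.relMap R fun i => M.eval (M.concat a b) (ts i)
  | _, .imp φ ψ, b => BRealize a φ b → BRealize a ψ b
  | _, .all s φ, b => ∀ e : M.carrier s, BRealize a φ (M.boundCons e b)

/-- `M ⊨ φ(a)`. -/
def Realize {X : L.Sorts → Type x} (φ : L.Formula X) (a : M.Tuple X) : Prop :=
  M.BRealize a φ M.boundNil

/-! ### Parameter sets, definable sets, types -/

/-- Sets of parameters in `M`: a set of elements of each sort. -/
abbrev Params : Type (max u w) := ∀ s : L.Sorts, Set (M.carrier s)

/-- The empty set of parameters. -/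
abbrev noParams : M.Params := fun _ => ∅

/-- A set of parameters, as a tuple of variables. -/
abbrev paramVars (A : M.Params) : L.Sorts → Type w := fun s => A s

/-- The tuple enumerating a set of parameters. -/
def paramTuple (A : M.Params) : M.Tuple (M.paramVars A) := fun _ e => e.1

/-- Formulas `φ(x, A)` with free variables in `X` and parameters from `A`. -/
abbrev FormulaOver (A : M.Params) (X : L.Sorts → Type x) : Type (max u v w x) :=
  L.Formula (Concat X (M.paramVars A))

variable {M}
variable {X : L.Sorts → Type x} {Y : L.Sorts → Type y}

/-- `M ⊨ φ(a, A)`. -/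
def RealizeOver {A : M.Params} (φ : M.FormulaOver A X) (a : M.Tuple X) : Prop :=
  M.Realize φ (M.concat a (M.paramTuple A))

/-- The complete type `tp(a/A)`, as a set of formulas. -/
def tp (A : M.Params) (a : M.Tuple X) : Set (M.FormulaOver A X) := {φ | RealizeOver φ a}

/-- `a ≡ b`: the tuples `a` and `b` have the same type over `∅`. -/
def SameType (a b : M.Tuple X) : Prop := tp M.noParams a = tp M.noParams b

/-- A set of tuples is definable over `A`. -/
def IsDefinable (A : M.Params) (D : Set (M.Tuple X)) : Prop :=
  ∃ φ : M.FormulaOver A X, D = {a | RealizeOver φ a}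

/-- A set of tuples is type-definable over `A`. -/
def IsTypeDefinable (A : M.Params) (D : Set (M.Tuple X)) : Prop :=
  ∃ Φ : Set (M.FormulaOver A X), D = {a | ∀ φ ∈ Φ, RealizeOver φ a}

variable (M X) in
/-- The space of complete types over `A` of elements of the product of sorts given by `X`. -/
def TypeSpace (A : M.Params) : Type (max u v w x) := range (tp A : M.Tuple X → _)

/-- The type of `a` over `A`, as a point of the type space. -/
def toType (A : M.Params) (a : M.Tuple X) : TypeSpace M X A := ⟨tp A a, a, rfl⟩

/-- The set of realisations in `M` of a type. -/
def TypeSpace.realisations {A : M.Params} (p : TypeSpace M X A) : Set (M.Tuple X) :=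
  {a | toType A a = p}

/-- The usual topology, with basis the sets `[φ] = {p | φ ∈ p}`. -/
instance (A : M.Params) : TopologicalSpace (TypeSpace M X A) :=
  TopologicalSpace.generateFrom (range fun φ : M.FormulaOver A X => {p | φ ∈ p.1})

/-- The complete type `p` is isolated. -/
def TypeSpace.IsIsolated {A : M.Params} (p : TypeSpace M X A) : Prop :=
  IsOpen ({p} : Set (TypeSpace M X A))

/-- The subset of the type space over `A` which corresponds to a set of tuples. -/
def typesOf (A : M.Params) (D : Set (M.Tuple X)) : Set (TypeSpace M X A) := toType A '' D

/-- The set of tuples `D` is `F_σ` over `A`: so is the corresponding set of types. -/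
def IsFSigma (A : M.Params) (D : Set (M.Tuple X)) : Prop :=
  ∃ F : ℕ → Set (TypeSpace M X A), (∀ n, IsClosed (F n)) ∧ typesOf A D = ⋃ n, F n

/-- A binary relation on tuples, as a set of concatenated pairs of tuples. -/
def relSet (R : M.Tuple X → M.Tuple X → Prop) : Set (M.Tuple (Concat X X)) :=
  {c | R (fun s i => c s (Sum.inl i)) (fun s i => c s (Sum.inr i))}

/-! ### Automorphisms and the monster model -/

variable (M) in
/-- The group of automorphisms of `M`. -/
def aut : Subgroup (∀ s : L.Sorts, Equiv.Perm (M.carrier s)) where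
  carrier := {g |
    (∀ (d : List L.Sorts) (s : L.Sorts) (f : L.Func d s)
      (a : ∀ i : Fin d.length, M.carrier (d.get i)),
      g s (M.funMap f a) = M.funMap f fun i => g (d.get i) (a i)) ∧
    ∀ (d : List L.Sorts) (R : L.Rel d) (a : ∀ i : Fin d.length, M.carrier (d.get i)),
      M.relMap R (fun i => g (d.get i) (a i)) ↔ M.relMap R a}
  mul_mem' := by
    rintro g h ⟨hg, hg'⟩ ⟨hh, hh'⟩
    refine ⟨fun d s f a => ?_, fun d R a => ?_⟩
    · simp only [Pi.mul_apply, Equiv.Perm.mul_apply, hh, hg]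
    · simp only [Pi.mul_apply, Equiv.Perm.mul_apply]
      rw [hg' d R fun i => h (d.get i) (a i), hh']
  one_mem' := by simp
  inv_mem' := by
    rintro g ⟨hg, hg'⟩
    refine ⟨fun d s f a => ?_, fun d R a => ?_⟩
    · simp only [Pi.inv_apply]
      rw [Equiv.Perm.inv_eq_iff_eq, hg]
      simp
    · rw [← hg']
      simp

/-- The action of (sort-preserving) permutations of `M` on tuples. -/
def act (g : ∀ s : L.Sorts, Equiv.Perm (M.carrier s)) (a : M.Tuple X) : M.Tuple X :=
  fun s i => g s (a s i)

variable (M) in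
/-- `M` is `κ`-saturated: every finitely satisfiable set of formulas in one variable over fewer than
`κ` parameters is realised in `M`. -/
def IsSaturated (κ : Cardinal.{max u w}) : Prop :=
  ∀ A : M.Params, #(Σ s, A s) < κ → ∀ (s : L.Sorts) (Φ : Set (M.FormulaOver A (Single s))),
    (∀ Ψ ⊆ Φ, Ψ.Finite → ∃ a : M.Tuple (Single s), ∀ φ ∈ Ψ, RealizeOver φ a) →
      ∃ a : M.Tuple (Single s), ∀ φ ∈ Φ, RealizeOver φ a

variable (M) in
/-- `M` is strongly `κ`-homogeneous: every elementary map whose domain is a subset of `M` with fewer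
than `κ` elements extends to an automorphism of `M`. -/
def IsStronglyHomogeneous (κ : Cardinal.{max u w}) : Prop :=
  ∀ A : M.Params, #(Σ s, A s) < κ → ∀ f : M.Tuple (M.paramVars A),
    (∀ φ : L.Formula (M.paramVars A), M.Realize φ (M.paramTuple A) ↔ M.Realize φ f) →
      ∃ g ∈ M.aut, act g (M.paramTuple A) = f

variable (M) in
/-- The structure induced on a family of subsets of the sorts which is closed under the functions
of `M`. -/
def induced (N : M.Params)
    (h : ∀ (d : List L.Sorts) (s : L.Sorts) (f : L.Func d s)
      (a : ∀ i : Fin d.length, M.carrier (d.get i)), (∀ i, a i ∈ N (d.get i)) →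
        M.funMap f a ∈ N s) : Str.{u, v, w} L where
  carrier s := N s
  funMap {d s} f a := ⟨M.funMap f fun i => (a i).1, h d s f _ fun i => (a i).2⟩
  relMap R a := M.relMap R fun i => (a i).1

variable (M) in
/-- `N` is (the universe of) an elementary substructure of `M`: it is closed under the functions of
`M`, and formulas with parameters from `N` have the same truth value in `N` and in `M`. -/
def IsElementarySub (N : M.Params) : Prop :=
  ∃ h, ∀ φ : L.Formula (M.paramVars N),
    (M.induced N h).Realize φ (fun _ e => e) ↔ M.Realize φ (M.paramTuple N)

/-! ### Equivalence relations on products of sorts -/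

/-- A relation on tuples is invariant under all automorphisms of `M`. -/
def IsInvariantRel (R : M.Tuple X → M.Tuple X → Prop) : Prop :=
  ∀ g ∈ M.aut, ∀ a b : M.Tuple X, R (act g a) (act g b) ↔ R a b

/-- The set of classes of an equivalence relation. -/
def classes {α : Type y} (R : α → α → Prop) : Set (Set α) := range fun a => {b | R a b}

/-- The restriction of the equivalence relation `R` to a set `D` is orbital: some group of
automorphisms preserves each class setwise and acts transitively on each class. -/
def IsOrbitalOn (R : M.Tuple X → M.Tuple X → Prop) (D : Set (M.Tuple X)) : Prop :=
  ∃ Γ : Subgroup (∀ s : L.Sorts, Equiv.Perm (M.carrier s)), Γ ≤ M.aut ∧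
    (∀ g ∈ Γ, ∀ a ∈ D, act g '' {b ∈ D | R a b} = {b ∈ D | R a b}) ∧
    ∀ a ∈ D, ∀ b ∈ D, R a b → ∃ g ∈ Γ, act g a = b

/-- The equivalence relation `R` is orbital on types: it refines type, and its restriction to (the
set of realisations of) any complete type over `∅` is orbital. -/
def IsOrbitalOnTypes (R : M.Tuple X → M.Tuple X → Prop) : Prop :=
  (∀ a b, R a b → SameType a b) ∧
    ∀ p : TypeSpace M X M.noParams, IsOrbitalOn R p.realisations

/-- The relation on types over `N` induced by a relation on tuples. -/
def onTypes (N : M.Params) (R : M.Tuple X → M.Tuple X → Prop) (p q : TypeSpace M X N) : Prop :=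
  ∃ a ∈ p.realisations, ∃ b ∈ q.realisations, R a b

end Str

end SortedLanguage

/-- Borel reducibility of relations on topological spaces. -/
def BorelReducible {α : Type x} {β : Type y} [TopologicalSpace α] [TopologicalSpace β]
    (E : α → α → Prop) (F : β → β → Prop) : Prop :=
  ∃ f : α → β, @Measurable α β (borel α) (borel β) f ∧ ∀ p q, E p q ↔ F (f p) (f q)

/-- A relation is smooth: it is Borel reducible to equality on some Polish space. -/
def IsSmoothRel {α : Type x} [TopologicalSpace α] (E : α → α → Prop) : Prop :=
  ∃ (Z : Type) (_ : TopologicalSpace Z), PolishSpace Z ∧ BorelReducible E (Eq : Z → Z → Prop)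

namespace SortedLanguage.Str

variable {L : SortedLanguage.{u, v}} {M : Str.{u, v, w} L} {X : L.Sorts → Type x}

/-- The relation `R` on tuples is smooth: the relation which it induces on types over a countable
elementary submodel `N` of `M` is smooth. This is required of all countable `N` (of which there has
to be one). -/
def IsSmooth (R : M.Tuple X → M.Tuple X → Prop) : Prop :=
  (∃ N : M.Params, M.IsElementarySub N ∧ Countable (Σ s, N s)) ∧
    ∀ N : M.Params, M.IsElementarySub N → Countable (Σ s, N s) → IsSmoothRel (onTypes N R)

/-- The relation `(E(x, y) ∨ ¬ p₀(x)) ∧ x ≡ y`. -/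
def cutRel (E : M.Tuple X → M.Tuple X → Prop) (p₀ : TypeSpace M X M.noParams)
    (a b : M.Tuple X) : Prop :=
  (E a b ∨ a ∉ p₀.realisations) ∧ SameType a b

end SortedLanguage.Str

open SortedLanguage.Str

/-!
Write `E'` for the relation `cutRel E p₀`: it is `E` on the realisations of `p₀`, and `≡` on those
of any other type.

The main consequence of saturation is that projections of type-definable sets are type-definable:
the types of their points form a closed set. It gives also that the bounded relation `E` has only
finitely many classes, each of which is then definable over any elementary submodel `N`. So `E'` is
separated by countably many sets which are type-definable over `N`: the sets definable over `∅`, and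
the intersections of `p₀(ℭ)` with the classes of `E`. Hence `E'` has at most `2 ^ ℵ₀` classes and
is smooth. It is `F_σ` because `x ⊭ p₀` means that `x` satisfies one of the countably many formulas
that are not in `p₀`.

As `p₀` is not isolated and there are only finitely many `E`-classes, `p₀` is a limit of types
`≠ p₀` of elements `b` of a single class, which also contains a realisation of `p₀`. By hypothesis
some automorphism `g` moves this class to a different one, so `b E' g b` but not `b E g b`. If `E'`
were type-definable, then so would be `E' ∖ E`. The types of the first coordinates of its elements
would form a closed set containing these `tp(b)`, hence `p₀`. But `E'` coincides with `E` at the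
realisations of `p₀`.

Finally, `≡` is orbital on types by homogeneity, so only the type `p₀` itself has to be considered
for orbitality, and there `E'` is `E ∩ ≡`.
-/

namespace SortedLanguage

variable {L : SortedLanguage.{u, v}} {X : L.Sorts → Type x} {Y : L.Sorts → Type y}

/-! ### Renaming variables -/

/-- Renaming the variables of a term. -/
def Term.rename (σ : ∀ s, X s → Y s) : {s : L.Sorts} → L.Term X s → L.Term Y s
  | _, .var i => .var (σ _ i)
  | _, .app f ts => .app f fun i => (ts i).rename σ

/-- The extension of a renaming of variables under a quantifier: the new bound variable is fixed,
and the images of the old variables are shifted past it. -/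
def liftRenaming {l l' : List L.Sorts} (t : L.Sorts)
    (σ : ∀ s, Concat X (Bound l) s → Concat Y (Bound l') s) :
    ∀ s, Concat X (Bound (t :: l)) s → Concat Y (Bound (t :: l')) s
  | _, .inl i => Sum.map id .succ (σ _ (.inl i))
  | _, .inr .zero => .inr .zero
  | _, .inr (.succ i) => Sum.map id .succ (σ _ (.inr i))

/-- Renaming the variables of a formula. A renaming may turn free variables into bound ones, which
is how quantification over a free variable is expressed, and bound variables into free ones. -/
def BoundedFormula.rename : {l l' : List L.Sorts} →
    (∀ s, Concat X (Bound l) s → Concat Y (Bound l') s) →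
      L.BoundedFormula X l → L.BoundedFormula Y l'
  | _, _, _, .falsum => .falsum
  | _, _, σ, .equal t₁ t₂ => .equal (t₁.rename σ) (t₂.rename σ)
  | _, _, σ, .rel R ts => .rel R fun i => (ts i).rename σ
  | _, _, σ, .imp φ ψ => .imp (φ.rename σ) (ψ.rename σ)
  | _, _, σ, .all s φ => .all s (φ.rename (liftRenaming s σ))

/-- Renaming the free variables of a formula. -/
def Formula.map (σ : ∀ s, X s → Y s) (φ : L.Formula X) : L.Formula Y :=
  φ.rename fun s => Sum.map (σ s) id

/-- The negation of a formula. -/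
def Formula.not (φ : L.Formula X) : L.Formula X := φ.imp .falsum

/-- Existential quantification over the first of the free variables of a formula. -/
def Formula.ex {s : L.Sorts} (φ : L.Formula (Concat (Single s) Y)) : L.Formula Y :=
  Formula.not <| .all s <| φ.not.rename fun t => Sum.elim
    (Sum.elim (fun i : Single s t => .inr (i.down ▸ .zero)) Sum.inl)
    fun i : Bound [] t => nomatch i

namespace Str

variable {M : Str.{u, v, w} L}

/-- Substitution of variables in a tuple, with `σ` giving the variable of `a` that is read at each
variable of the new tuple. -/
def reindex (σ : ∀ s, X s → Y s) (a : M.Tuple Y) : M.Tuple X := fun s i => a s (σ s i)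

/-- The tuple of length one with value `e`. -/
def single {s : L.Sorts} (e : M.carrier s) : M.Tuple (Single s) := fun _ i => i.down ▸ e

theorem single_apply {s : L.Sorts} (a : M.Tuple (Single s)) : single (a s ⟨rfl⟩) = a := by
  funext t ⟨rfl⟩
  rfl

theorem eval_rename (σ : ∀ s, X s → Y s) (a : M.Tuple Y) {s : L.Sorts} (t : L.Term X s) :
    M.eval a (t.rename σ) = M.eval (reindex σ a) t := by
  induction t with
  | var i => rfl
  | app f ts ih => simp only [Term.rename, eval, ih]

theorem reindex_liftRenaming {l l' : List L.Sorts} (t : L.Sorts)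
    (σ : ∀ s, Concat X (Bound l) s → Concat Y (Bound l') s) {a : M.Tuple Y} {a' : M.Tuple X}
    {b : M.Tuple (Bound l')} {b' : M.Tuple (Bound l)}
    (h : reindex σ (M.concat a b) = M.concat a' b') (e : M.carrier t) :
    reindex (liftRenaming t σ) (M.concat a (M.boundCons e b)) =
      M.concat a' (M.boundCons e b') := by
  have shift (s : L.Sorts) (j : Concat Y (Bound l') s) :
      M.concat a (M.boundCons e b) s (Sum.map id .succ j) = M.concat a b s j := by
    cases j <;> rfl
  funext s i
  match s, i with
  | _, .inl i => exact (shift _ _).trans (congrFun₂ h _ (.inl i))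
  | _, .inr .zero => rfl
  | _, .inr (.succ i) => exact (shift _ _).trans (congrFun₂ h _ (.inr i))

theorem bRealize_rename {l l' : List L.Sorts}
    (σ : ∀ s, Concat X (Bound l) s → Concat Y (Bound l') s) (φ : L.BoundedFormula X l)
    {a : M.Tuple Y} {a' : M.Tuple X} {b : M.Tuple (Bound l')} {b' : M.Tuple (Bound l)}
    (h : reindex σ (M.concat a b) = M.concat a' b') :
    M.BRealize a (φ.rename σ) b ↔ M.BRealize a' φ b' := by
  induction φ generalizing l' with
  | falsum => rfl
  | equal t₁ t₂ => simp only [BoundedFormula.rename, BRealize, eval_rename, h]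
  | rel R ts => simp only [BoundedFormula.rename, BRealize, eval_rename, h]
  | imp φ ψ ihφ ihψ => exact imp_congr (ihφ σ h) (ihψ σ h)
  | all s φ ih => exact forall_congr' fun e => ih _ (reindex_liftRenaming s σ h e)

theorem realize_map (σ : ∀ s, X s → Y s) (φ : L.Formula X) (a : M.Tuple Y) :
    M.Realize (φ.map σ) a ↔ M.Realize φ (reindex σ a) :=
  bRealize_rename _ φ (by funext s i; rcases i with i | i; exacts [rfl, nomatch i])

theorem realize_ex {s : L.Sorts} (φ : L.Formula (Concat (Single s) Y)) (a : M.Tuple Y) :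
    M.Realize φ.ex a ↔ ∃ e, M.Realize φ (M.concat (single e) a) := by
  rw [← not_forall_not]
  refine not_congr (forall_congr' fun e => bRealize_rename _ φ.not ?_)
  funext t i
  rcases i with (⟨⟨rfl⟩⟩ | i) | i
  exacts [rfl, rfl, nomatch i]

/-! ### Finite supports -/

/-- Two tuples agree at the variables in `S`. Variables are collected over all sorts. -/
def AgreeOn (S : Set (Σ s, X s)) (a a' : M.Tuple X) : Prop := ∀ k ∈ S, a k.1 k.2 = a' k.1 k.2

/-- Membership of a tuple in `D` depends only on the values at the variables in `S`. -/
def SupportedOn (S : Set (Σ s, X s)) (D : Set (M.Tuple X)) : Prop :=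
  ∀ a a', AgreeOn S a a' → (a ∈ D ↔ a' ∈ D)

theorem AgreeOn.mono {S T : Set (Σ s, X s)} {a a' : M.Tuple X} (h : AgreeOn T a a')
    (hST : S ⊆ T) : AgreeOn S a a' :=
  fun k hk => h k (hST hk)

theorem AgreeOn.concat {S : Set (Σ s, Concat X Y s)} {a a' : M.Tuple X} {b b' : M.Tuple Y}
    (ha : AgreeOn (Sigma.map id (fun _ => Sum.inl) ⁻¹' S) a a')
    (hb : AgreeOn (Sigma.map id (fun _ => Sum.inr) ⁻¹' S) b b') :
    AgreeOn S (M.concat a b) (M.concat a' b') := by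
  rintro ⟨s, i | i⟩ hk
  exacts [ha ⟨s, i⟩ hk, hb ⟨s, i⟩ hk]

theorem finite_preimage_inl {S : Set (Σ s, Concat X Y s)} (hS : S.Finite) :
    (Sigma.map id (fun _ => Sum.inl) ⁻¹' S : Set (Σ s, X s)).Finite :=
  hS.preimage <| by rintro ⟨s, i⟩ _ ⟨t, j⟩ _ ⟨⟩; rfl

theorem finite_preimage_inr {S : Set (Σ s, Concat X Y s)} (hS : S.Finite) :
    (Sigma.map id (fun _ => Sum.inr) ⁻¹' S : Set (Σ s, Y s)).Finite :=
  hS.preimage <| by rintro ⟨s, i⟩ _ ⟨t, j⟩ _ ⟨⟩; rfl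

theorem exists_finite_eval_congr {s : L.Sorts} (t : L.Term X s) :
    ∃ F : Set (Σ s, X s), F.Finite ∧
      ∀ a a' : M.Tuple X, AgreeOn F a a' → M.eval a t = M.eval a' t := by
  induction t with
  | var i => exact ⟨{⟨_, i⟩}, finite_singleton _, fun a a' h => h ⟨_, i⟩ rfl⟩
  | app f ts ih =>
    choose F hfin hF using ih
    exact ⟨⋃ i, F i, finite_iUnion hfin, fun a a' h => congrArg (M.funMap f) <| funext fun i =>
      hF i a a' (h.mono (subset_iUnion F i))⟩

theorem exists_finite_eval_concat_congr {l : List L.Sorts} {s : L.Sorts}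
    (t : L.Term (Concat X (Bound l)) s) :
    ∃ F : Set (Σ s, X s), F.Finite ∧ ∀ a a' : M.Tuple X, AgreeOn F a a' →
      ∀ b : M.Tuple (Bound l), M.eval (M.concat a b) t = M.eval (M.concat a' b) t := by
  obtain ⟨F, hfin, hF⟩ := exists_finite_eval_congr (M := M) t
  exact ⟨_, finite_preimage_inl hfin, fun a a' h b => hF _ _ (h.concat fun _ _ => rfl)⟩

theorem exists_finite_bRealize_congr {l : List L.Sorts} (φ : L.BoundedFormula X l) :
    ∃ F : Set (Σ s, X s), F.Finite ∧ ∀ a a' : M.Tuple X, AgreeOn F a a' →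
      ∀ b : M.Tuple (Bound l), M.BRealize a φ b ↔ M.BRealize a' φ b := by
  induction φ with
  | falsum => exact ⟨∅, finite_empty, fun _ _ _ _ => Iff.rfl⟩
  | equal t₁ t₂ =>
    obtain ⟨F₁, hfin₁, h₁⟩ := exists_finite_eval_concat_congr (M := M) t₁
    obtain ⟨F₂, hfin₂, h₂⟩ := exists_finite_eval_concat_congr (M := M) t₂
    refine ⟨F₁ ∪ F₂, hfin₁.union hfin₂, fun a a' h b => ?_⟩
    rw [BRealize, BRealize, h₁ a a' (h.mono subset_union_left),
      h₂ a a' (h.mono subset_union_right)]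
  | rel R ts =>
    choose F hfin hF using fun i => exists_finite_eval_concat_congr (M := M) (ts i)
    refine ⟨⋃ i, F i, finite_iUnion hfin, fun a a' h b => ?_⟩
    rw [BRealize, BRealize, funext fun i => hF i a a' (h.mono (subset_iUnion F i)) b]
  | imp φ ψ ihφ ihψ =>
    obtain ⟨F₁, hfin₁, h₁⟩ := ihφ
    obtain ⟨F₂, hfin₂, h₂⟩ := ihψ
    exact ⟨F₁ ∪ F₂, hfin₁.union hfin₂, fun a a' h b => imp_congr
      (h₁ a a' (h.mono subset_union_left) b) (h₂ a a' (h.mono subset_union_right) b)⟩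
  | all s φ ih =>
    obtain ⟨F, hfin, hF⟩ := ih
    exact ⟨F, hfin, fun a a' h b => forall_congr' fun e => hF a a' h _⟩

theorem exists_finite_supportedOn_setOf_realize (φ : L.Formula X) :
    ∃ F : Set (Σ s, X s), F.Finite ∧ SupportedOn F {a : M.Tuple X | M.Realize φ a} :=
  (exists_finite_bRealize_congr φ).imp fun _ h => ⟨h.1, fun a a' ha => h.2 a a' ha _⟩

/-! ### Automorphisms -/

theorem eval_act {g : ∀ s : L.Sorts, Equiv.Perm (M.carrier s)} (hg : g ∈ M.aut) (a : M.Tuple X)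
    {s : L.Sorts} (t : L.Term X s) : M.eval (act g a) t = g s (M.eval a t) := by
  induction t with
  | var i => rfl
  | app f ts ih => simp only [eval, ih, hg.1]

theorem act_concat (g : ∀ s : L.Sorts, Equiv.Perm (M.carrier s)) (a : M.Tuple X)
    (b : M.Tuple Y) : act g (M.concat a b) = M.concat (act g a) (act g b) := by
  funext s i
  cases i <;> rfl

theorem act_boundCons (g : ∀ s : L.Sorts, Equiv.Perm (M.carrier s)) {l : List L.Sorts}
    {t : L.Sorts} (e : M.carrier t) (b : M.Tuple (Bound l)) :
    act g (M.boundCons e b) = M.boundCons (g t e) (act g b) := by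
  funext s i
  cases i <;> rfl

theorem bRealize_act {g : ∀ s : L.Sorts, Equiv.Perm (M.carrier s)} (hg : g ∈ M.aut)
    (a : M.Tuple X) {l : List L.Sorts} (φ : L.BoundedFormula X l) (b : M.Tuple (Bound l)) :
    M.BRealize (act g a) φ (act g b) ↔ M.BRealize a φ b := by
  induction φ with
  | falsum => rfl
  | equal t₁ t₂ =>
    simp only [BRealize, ← act_concat, eval_act hg, EmbeddingLike.apply_eq_iff_eq]
  | rel R ts => simp only [BRealize, ← act_concat, eval_act hg, hg.2]
  | imp φ ψ ihφ ihψ => exact imp_congr (ihφ b) (ihψ b)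
  | all s φ ih =>
    simp only [BRealize, ← ih, act_boundCons]
    exact (g s).forall_congr_right.symm

theorem realize_act {g : ∀ s : L.Sorts, Equiv.Perm (M.carrier s)} (hg : g ∈ M.aut)
    (φ : L.Formula X) (a : M.Tuple X) : M.Realize φ (act g a) ↔ M.Realize φ a := by
  have hnil : act g M.boundNil = M.boundNil := by
    funext s i
    nomatch i
  rw [Realize, Realize, ← bRealize_act hg a, hnil]

end Str

/-! ### Counting formulas -/

instance {S : Type u} {X : S → Type x} {Y : S → Type y} [Countable (Σ s, X s)]
    [Countable (Σ s, Y s)] : Countable (Σ s, Concat X Y s) :=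
  (Equiv.sigmaSumDistrib X Y).injective.countable

instance {S : Type u} (s : S) : Countable (Σ t, Single s t) :=
  have : Subsingleton (Σ t, Single s t) := ⟨by rintro ⟨_, ⟨rfl⟩⟩ ⟨_, ⟨rfl⟩⟩; rfl⟩
  inferInstance

instance {S : Type u} (l : List S) : Countable (Σ s, Bound l s) := by
  induction l with
  | nil =>
    have : IsEmpty (Σ s : S, Bound [] s) := ⟨fun ⟨_, i⟩ => nomatch i⟩
    infer_instance
  | cons t l ih =>
    refine Function.Surjective.countable (α := Option (Σ s, Bound l s))
      (f := fun o => o.elim ⟨t, .zero⟩ fun k => ⟨k.1, .succ k.2⟩) ?_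
    rintro ⟨s, _ | i⟩
    exacts [⟨none, rfl⟩, ⟨some ⟨s, i⟩, rfl⟩]

/-- The terms of depth less than `n`; there are countably many for each `n`. -/
def termsOfDepth (X : L.Sorts → Type x) : ℕ → ∀ s, Set (L.Term X s)
  | 0, _ => ∅
  | n + 1, s => termsOfDepth X n s ∪ (range .var ∪ ⋃ (d) (f : L.Func d s),
      Term.app f '' univ.pi fun i => termsOfDepth X n (d.get i))

theorem termsOfDepth_mono (s : L.Sorts) : Monotone fun n => termsOfDepth X n s :=
  monotone_nat_of_le_succ fun _ => subset_union_left

theorem exists_mem_termsOfDepth {s : L.Sorts} (t : L.Term X s) :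
    ∃ n, t ∈ termsOfDepth X n s := by
  induction t with
  | var i => exact ⟨1, .inr <| .inl ⟨i, rfl⟩⟩
  | app f ts ih =>
    choose n hn using ih
    refine ⟨Finset.univ.sup n + 1, .inr <| .inr <| mem_iUnion₂.2 ⟨_, f, ts, fun i _ => ?_, rfl⟩⟩
    exact termsOfDepth_mono _ (Finset.le_sup (Finset.mem_univ i)) (hn i)

theorem countable_termsOfDepth (hL : L.IsCountable) [Countable (Σ s, X s)] (n : ℕ)
    (s : L.Sorts) : (termsOfDepth X n s).Countable := by
  have hSorts := hL.1
  have hFuncs := hL.2.1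
  have hFunc (d s) : Countable (L.Func d s) :=
    Function.Injective.countable (β := Σ (d : List L.Sorts) (s : L.Sorts), L.Func d s)
      (f := fun f => ⟨d, s, f⟩) fun f g h => by simpa using h
  have hVar (s) : Countable (X s) := (sigma_mk_injective (i := s)).countable
  induction n generalizing s with
  | zero => exact countable_empty
  | succ n ih =>
    exact (ih s).union <| (countable_range _).union <| countable_iUnion fun d =>
      countable_iUnion fun f => (countable_univ_pi fun i => ih _).image _

theorem Term.countable (hL : L.IsCountable) [Countable (Σ s, X s)] (s : L.Sorts) :
    Countable (L.Term X s) :=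
  countable_univ_iff.1 <| (countable_iUnion fun n => countable_termsOfDepth hL n s).mono
    fun t _ => mem_iUnion.2 (exists_mem_termsOfDepth t)

/-- The formulas of depth less than `n`; there are countably many for each `n`. -/
def formulasOfDepth (X : L.Sorts → Type x) : ℕ → ∀ l, Set (L.BoundedFormula X l)
  | 0, _ => ∅
  | n + 1, l => formulasOfDepth X n l ∪ ({.falsum} ∪
      ((⋃ s, range fun t : L.Term (Concat X (Bound l)) s × L.Term (Concat X (Bound l)) s =>
        .equal t.1 t.2) ∪
      ((⋃ (d) (R : L.Rel d), range (.rel R)) ∪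
      (image2 .imp (formulasOfDepth X n l) (formulasOfDepth X n l) ∪
      ⋃ s, .all s '' formulasOfDepth X n (s :: l)))))

theorem formulasOfDepth_mono (l : List L.Sorts) : Monotone fun n => formulasOfDepth X n l :=
  monotone_nat_of_le_succ fun _ => subset_union_left

theorem exists_mem_formulasOfDepth {l : List L.Sorts} (φ : L.BoundedFormula X l) :
    ∃ n, φ ∈ formulasOfDepth X n l := by
  induction φ with
  | falsum => exact ⟨1, .inr <| .inl rfl⟩
  | equal t₁ t₂ => exact ⟨1, .inr <| .inr <| .inl <| mem_iUnion.2 ⟨_, (t₁, t₂), rfl⟩⟩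
  | rel R ts => exact ⟨1, .inr <| .inr <| .inr <| .inl <| mem_iUnion₂.2 ⟨_, R, ts, rfl⟩⟩
  | imp φ ψ ihφ ihψ =>
    obtain ⟨m, hm⟩ := ihφ
    obtain ⟨n, hn⟩ := ihψ
    exact ⟨max m n + 1, .inr <| .inr <| .inr <| .inr <| .inl
      ⟨φ, formulasOfDepth_mono _ (le_max_left m n) hm, ψ,
        formulasOfDepth_mono _ (le_max_right m n) hn, rfl⟩⟩
  | all s φ ih =>
    obtain ⟨n, hn⟩ := ih
    exact ⟨n + 1, .inr <| .inr <| .inr <| .inr <| .inr <| mem_iUnion.2 ⟨s, φ, hn, rfl⟩⟩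

theorem countable_formulasOfDepth (hL : L.IsCountable) [Countable (Σ s, X s)] (n : ℕ)
    (l : List L.Sorts) : (formulasOfDepth X n l).Countable := by
  have hSorts := hL.1
  have hRels := hL.2.2
  have hRel (d) : Countable (L.Rel d) := (sigma_mk_injective (β := L.Rel) (i := d)).countable
  have hTerm (l : List L.Sorts) (s) : Countable (L.Term (Concat X (Bound l)) s) :=
    Term.countable hL s
  induction n generalizing l with
  | zero => exact countable_empty
  | succ n ih =>
    exact (ih l).union <| (countable_singleton _).union <|
      (countable_iUnion fun s => countable_range _).union <|
      (countable_iUnion fun d => countable_iUnion fun R => countable_range _).union <|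
      ((ih l).image2 (ih l) _).union <| countable_iUnion fun s => (ih _).image _

theorem BoundedFormula.countable (hL : L.IsCountable) [Countable (Σ s, X s)]
    (l : List L.Sorts) : Countable (L.BoundedFormula X l) :=
  countable_univ_iff.1 <| (countable_iUnion fun n => countable_formulasOfDepth hL n l).mono
    fun φ _ => mem_iUnion.2 (exists_mem_formulasOfDepth φ)

end SortedLanguage

namespace SortedLanguage.Str

variable {L : SortedLanguage.{u, v}} {M : Str.{u, v, w} L} {X : L.Sorts → Type x}
  {Y : L.Sorts → Type y} {A B : M.Params}

/-! ### Definable sets -/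

theorem isDefinable_setOf_realize (φ : L.Formula X) :
    IsDefinable A {a : M.Tuple X | M.Realize φ a} :=
  ⟨φ.map fun _ => .inl, ext fun a =>
    (realize_map (fun _ => Sum.inl) φ (M.concat a (M.paramTuple A))).symm⟩

theorem isDefinable_univ : IsDefinable A (univ : Set (M.Tuple X)) :=
  ⟨.imp .falsum .falsum, (eq_univ_of_forall fun _ h => h).symm⟩

theorem IsDefinable.compl {D : Set (M.Tuple X)} (hD : IsDefinable A D) : IsDefinable A Dᶜ := by
  obtain ⟨φ, rfl⟩ := hD
  exact ⟨Formula.not φ, rfl⟩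

theorem IsDefinable.inter {D D' : Set (M.Tuple X)} (hD : IsDefinable A D)
    (hD' : IsDefinable A D') : IsDefinable A (D ∩ D') := by
  obtain ⟨φ, rfl⟩ := hD
  obtain ⟨ψ, rfl⟩ := hD'
  exact ⟨Formula.not (.imp φ (Formula.not ψ)),
    ext fun a => (Classical.not_imp.trans (and_congr_right fun _ => not_not)).symm⟩

theorem IsDefinable.union {D D' : Set (M.Tuple X)} (hD : IsDefinable A D)
    (hD' : IsDefinable A D') : IsDefinable A (D ∪ D') := by
  rw [← compl_compl (D ∪ D'), compl_union]
  exact (hD.compl.inter hD'.compl).compl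

theorem IsDefinable.iff {D D' : Set (M.Tuple X)} (hD : IsDefinable A D)
    (hD' : IsDefinable A D') : IsDefinable A {a | a ∈ D ↔ a ∈ D'} := by
  convert (hD.inter hD').union (hD.compl.inter hD'.compl) using 1
  exact ext fun a => iff_iff_and_or_not_and_not

theorem IsDefinable.sInter {T : Set (Set (M.Tuple X))} (hT : T.Finite)
    (hdef : ∀ D ∈ T, IsDefinable A D) : IsDefinable A (⋂₀ T) := by
  induction T, hT using Set.Finite.induction_on with
  | empty => exact sInter_empty ▸ isDefinable_univ
  | insert _ _ ih =>
    rw [sInter_insert]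
    exact (hdef _ (mem_insert _ _)).inter (ih fun D hD => hdef D (mem_insert_of_mem _ hD))

theorem IsDefinable.preimage {D : Set (M.Tuple X)} (hD : IsDefinable A D) (hAB : A ≤ B)
    (σ : ∀ s, X s → Concat Y (M.paramVars B) s) :
    IsDefinable B {a : M.Tuple Y | reindex σ (M.concat a (M.paramTuple B)) ∈ D} := by
  obtain ⟨φ, rfl⟩ := hD
  refine ⟨φ.map fun s => Sum.elim (σ s) fun e => .inr ⟨e.1, hAB s e.2⟩, ext fun a => ?_⟩
  refine .trans ?_ (realize_map _ φ _).symm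
  refine iff_of_eq (congrArg (M.Realize φ) ?_)
  funext s i
  cases i <;> rfl

theorem IsDefinable.mono {D : Set (M.Tuple X)} (hD : IsDefinable A D) (hAB : A ≤ B) :
    IsDefinable B D :=
  hD.preimage hAB fun _ => .inl

theorem IsDefinable.preimage_reindex {D : Set (M.Tuple X)} (hD : IsDefinable A D)
    (σ : ∀ s, X s → Y s) : IsDefinable A (reindex σ ⁻¹' D) :=
  hD.preimage le_rfl fun s i => .inl (σ s i)

theorem IsDefinable.fiber {D : Set (M.Tuple (Concat X Y))} (hD : IsDefinable A D) (hAB : A ≤ B)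
    {c : M.Tuple Y} (hc : ∀ s i, c s i ∈ B s) : IsDefinable B {a | M.concat a c ∈ D} := by
  convert hD.preimage hAB fun s => Sum.elim .inl fun i => .inr ⟨c s i, hc s i⟩ using 4 with a
  funext s i
  cases i <;> rfl

theorem IsDefinable.setOf_exists {s : L.Sorts} {D : Set (M.Tuple (Concat (Single s) X))}
    (hD : IsDefinable A D) : IsDefinable A {a | ∃ e, M.concat (single e) a ∈ D} := by
  obtain ⟨φ, rfl⟩ := hD
  refine ⟨Formula.ex (φ.map fun t => Equiv.sumAssoc _ _ _), ext fun a => ?_⟩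
  refine .trans (exists_congr fun e => ?_) (realize_ex _ _).symm
  refine .trans (iff_of_eq (congrArg (M.Realize φ) ?_)) (realize_map _ φ _).symm
  funext t i
  rcases i with (i | i) | i <;> rfl

theorem IsDefinable.exists_finite_supportedOn {D : Set (M.Tuple X)} (hD : IsDefinable A D) :
    ∃ F : Set (Σ s, X s), F.Finite ∧ SupportedOn F D := by
  obtain ⟨φ, rfl⟩ := hD
  obtain ⟨F, hfin, hF⟩ := exists_finite_supportedOn_setOf_realize (M := M) φ
  exact ⟨_, finite_preimage_inl hfin, fun a a' h => hF _ _ (h.concat fun _ _ => rfl)⟩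

open Classical in
theorem IsDefinable.exists_finite_params {D : Set (M.Tuple X)} (hD : IsDefinable A D) :
    ∃ F : Set (Σ s, A s), F.Finite ∧ ∀ B : M.Params, (∀ s, (A s).Nonempty → (B s).Nonempty) →
      (∀ k ∈ F, k.2.1 ∈ B k.1) → IsDefinable B D := by
  obtain ⟨φ, rfl⟩ := hD
  obtain ⟨F, hfin, hF⟩ := exists_finite_supportedOn_setOf_realize (M := M) φ
  refine ⟨_, finite_preimage_inr hfin, fun B hne hB => ?_⟩
  let r (s : L.Sorts) (e : A s) : B s :=
    if h : e.1 ∈ B s then ⟨e, h⟩ else ⟨_, (hne s ⟨e, e.2⟩).some_mem⟩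
  have hr : AgreeOn (Sigma.map id (fun _ => Sum.inr) ⁻¹' F) (M.paramTuple A)
      (reindex r (M.paramTuple B)) := fun k hk => by
    simp only [reindex, paramTuple, r, dif_pos (hB k hk)]
  refine ⟨φ.map fun s => Sum.map id (r s), ext fun a => ?_⟩
  have hconcat : reindex (fun s => Sum.map id (r s)) (M.concat a (M.paramTuple B)) =
      M.concat a (reindex r (M.paramTuple B)) := by
    funext s i
    cases i <;> rfl
  refine .trans ?_ (realize_map _ φ _).symm
  rw [hconcat]
  exact hF _ _ (AgreeOn.concat (fun _ _ => rfl) hr)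

theorem IsDefinable.act_mem_iff {D : Set (M.Tuple X)} (hD : IsDefinable M.noParams D)
    {g : ∀ s : L.Sorts, Equiv.Perm (M.carrier s)} (hg : g ∈ M.aut) (a : M.Tuple X) :
    act g a ∈ D ↔ a ∈ D := by
  obtain ⟨φ, rfl⟩ := hD
  refine .trans (iff_of_eq (congrArg (M.Realize φ) ?_)) (realize_act hg φ _)
  rw [act_concat]
  congr 1
  funext s e
  exact e.2.elim

/-! ### Changing one coordinate -/

open Classical in
/-- The substitution of variables underlying `updateAt`: the variable `k` is replaced by the
additional one, and the other variables are kept. -/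
noncomputable def updateVar (k : Σ s, X s) (s : L.Sorts) (i : X s) : Concat (Single k.1) X s :=
  if h : k = ⟨s, i⟩ then .inl ⟨congrArg Sigma.fst h⟩ else .inr i

/-- The tuple `a` with its value at the variable `k` changed to `e`. It is expressed as a
substitution of variables to make it compatible with definability. -/
noncomputable def updateAt (a : M.Tuple X) (k : Σ s, X s) (e : M.carrier k.1) : M.Tuple X :=
  reindex (updateVar k) (M.concat (single e) a)

theorem updateAt_self (a : M.Tuple X) (k : Σ s, X s) (e : M.carrier k.1) :
    updateAt a k e k.1 k.2 = e := by
  simp only [updateAt, reindex, updateVar, dif_pos, concat, Sum.elim_inl, single]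

theorem updateAt_of_ne (a : M.Tuple X) {k j : Σ s, X s} (hjk : j ≠ k) (e : M.carrier k.1) :
    updateAt a k e j.1 j.2 = a j.1 j.2 := by
  simp only [updateAt, reindex, updateVar, dif_neg hjk.symm, concat, Sum.elim_inr]

theorem updateAt_eq_self (a : M.Tuple X) (k : Σ s, X s) : updateAt a k (a k.1 k.2) = a := by
  funext s i
  by_cases h : ⟨s, i⟩ = k
  · subst h
    exact updateAt_self a _ _
  · exact updateAt_of_ne a h _

theorem agreeOn_updateAt {S : Set (Σ s, X s)} {k : Σ s, X s} (hk : k ∉ S) (a : M.Tuple X)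
    (e : M.carrier k.1) : AgreeOn S a (updateAt a k e) :=
  fun _ hj => (updateAt_of_ne a (ne_of_mem_of_not_mem hj hk) e).symm

theorem AgreeOn.updateAt {S : Set (Σ s, X s)} {a a' : M.Tuple X} (h : AgreeOn S a a')
    (k : Σ s, X s) (e : M.carrier k.1) :
    AgreeOn (insert k S) (updateAt a k e) (updateAt a' k e) := by
  rintro j hj
  by_cases hjk : j = k
  · subst hjk
    rw [updateAt_self, updateAt_self]
  · rw [updateAt_of_ne a hjk, updateAt_of_ne a' hjk, h j (mem_of_mem_insert_of_ne hj hjk)]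

theorem SupportedOn.setOf_exists_updateAt {D : Set (M.Tuple X)} {S : Set (Σ s, X s)}
    {k : Σ s, X s} (hD : SupportedOn (insert k S) D) :
    SupportedOn S {a | ∃ e, updateAt a k e ∈ D} :=
  fun _ _ h => exists_congr fun e => hD _ _ (h.updateAt k e)

theorem IsDefinable.setOf_exists_updateAt {D : Set (M.Tuple X)} (hD : IsDefinable A D)
    (k : Σ s, X s) : IsDefinable A {a | ∃ e, updateAt a k e ∈ D} :=
  (hD.preimage_reindex (updateVar k)).setOf_exists

theorem IsDefinable.setOf_updateAt_mem {D : Set (M.Tuple X)} (hD : IsDefinable A D) (hAB : A ≤ B)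
    {c : M.Tuple X} (hc : ∀ s i, c s i ∈ B s) (k : Σ s, X s) :
    IsDefinable B {x : M.Tuple (Single k.1) | updateAt c k (x k.1 ⟨rfl⟩) ∈ D} := by
  simp only [updateAt, single_apply]
  exact (hD.preimage_reindex (updateVar k)).fiber hAB hc

/-! ### Saturation -/

/-- The set of values of a tuple, as a set of parameters. -/
def valueParams (c : M.Tuple X) : M.Params := fun s => range (c s)

theorem mk_valueParams_le [Countable (Σ s, X s)] (c : M.Tuple X) :
    #(Σ s, valueParams c s) ≤ ℵ₀ := by
  have : Function.Surjective
      (Sigma.map id (fun s i => ⟨c s i, i, rfl⟩) : (Σ s, X s) → Σ s, valueParams c s) := by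
    rintro ⟨s, _, i, rfl⟩
    exact ⟨⟨s, i⟩, rfl⟩
  exact mk_le_aleph0_iff.2 this.countable

theorem mk_sup_params_lt {κ : Cardinal.{max u w}} (hκ : ℵ₀ ≤ κ) (hA : #(Σ s, A s) < κ)
    (hB : #(Σ s, B s) < κ) : #(Σ s, (A ⊔ B) s) < κ := by
  have hsurj : Function.Surjective
      (Sum.elim (Sigma.map id fun s => inclusion subset_union_left)
        (Sigma.map id fun s => inclusion subset_union_right) :
        (Σ s, A s) ⊕ (Σ s, B s) → Σ s, (A ⊔ B) s) := by
    rintro ⟨s, e, he | he⟩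
    exacts [⟨.inl ⟨s, e, he⟩, rfl⟩, ⟨.inr ⟨s, e, he⟩, rfl⟩]
  exact (mk_le_of_surjective hsurj).trans_lt (by
    simpa only [mk_sum, lift_id] using add_lt_of_lt hκ hA hB)

theorem IsSaturated.exists_single_mem {κ : Cardinal.{max u w}} (hsat : M.IsSaturated κ)
    (hA : #(Σ s, A s) < κ) {s : L.Sorts} (f : Filter (M.Tuple (Single s))) [f.NeBot] :
    ∃ a, ∀ D ∈ f, IsDefinable A D → a ∈ D := by
  obtain ⟨a, ha⟩ := hsat A hA s {φ | {a | RealizeOver φ a} ∈ f} fun Ψ hΨ hfin => by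
    obtain ⟨a, ha⟩ := f.nonempty_of_mem ((Filter.biInter_mem hfin).2 hΨ)
    exact ⟨a, fun φ hφ => mem_iInter₂.1 ha φ hφ⟩
  exact ⟨a, fun D hD hdef => by obtain ⟨φ, rfl⟩ := hdef; exact ha φ hD⟩

/-- The tuple `c` belongs to all sets in the filter `f` which are definable over `A` and only
depend on the variables in `S`. -/
def AdheresOn (A : M.Params) (S : Set (Σ s, X s)) (f : Filter (M.Tuple X)) (c : M.Tuple X) :
    Prop :=
  ∀ D ∈ f, IsDefinable A D → SupportedOn S D → c ∈ D

theorem IsSaturated.exists_adheresOn_insert [Countable (Σ s, X s)] {κ : Cardinal.{max u w}}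
    (hsat : M.IsSaturated κ) (hκ : ℵ₀ < κ) (hA : #(Σ s, A s) < κ) {S : Set (Σ s, X s)}
    {f : Filter (M.Tuple X)} {c : M.Tuple X} (hc : AdheresOn A S f c) (k : Σ s, X s) :
    ∃ e, AdheresOn A (insert k S) f (updateAt c k e) := by
  let 𝒟 : Set (Set (M.Tuple X)) := {D | D ∈ f ∧ IsDefinable A D ∧ SupportedOn (insert k S) D}
  let f' : Filter (M.Tuple (Single k.1)) :=
    .comap (fun x => updateAt c k (x k.1 ⟨rfl⟩)) (.generate 𝒟)
  have : f'.NeBot := Filter.comap_neBot fun t ht => by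
    obtain ⟨T, hT, hfin, hTt⟩ := Filter.mem_generate_iff.1 ht
    have hdef : IsDefinable A (⋂₀ T) := .sInter hfin fun D hD => (hT hD).2.1
    have hsupp : SupportedOn (insert k S) (⋂₀ T) := fun a a' h =>
      forall₂_congr fun D hD => (hT hD).2.2 a a' h
    have hmem : {a | ∃ e, updateAt a k e ∈ ⋂₀ T} ∈ f :=
      Filter.mem_of_superset ((Filter.sInter_mem hfin).2 fun D hD => (hT hD).1)
        fun a ha => ⟨a k.1 k.2, (updateAt_eq_self a k).symm ▸ ha⟩
    obtain ⟨e, he⟩ := hc _ hmem (hdef.setOf_exists_updateAt k) hsupp.setOf_exists_updateAt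
    exact ⟨single e, hTt he⟩
  have hB : #(Σ s, (A ⊔ valueParams c) s) < κ :=
    mk_sup_params_lt hκ.le hA ((mk_valueParams_le c).trans_lt hκ)
  obtain ⟨x, hx⟩ := hsat.exists_single_mem hB f'
  refine ⟨x k.1 ⟨rfl⟩, fun D hD hdef hsupp => hx _ ?_
    (hdef.setOf_updateAt_mem le_sup_left (fun _ i => Or.inr (mem_range_self i)) k)⟩
  have hD𝒟 : D ∈ 𝒟 := ⟨hD, hdef, hsupp⟩
  exact Filter.preimage_mem_comap (Filter.mem_generate_of_mem hD𝒟)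

theorem exists_limit_of_agreeOn (enc : (Σ s, X s) → ℕ) {P : ℕ → M.Tuple X → Prop}
    (hzero : ∃ c, P 0 c)
    (hsucc : ∀ n c, P n c → ∃ c', P (n + 1) c' ∧ AgreeOn {k | enc k < n} c c') :
    ∃ c, ∀ n, ∃ c', P n c' ∧ AgreeOn {k | enc k < n} c c' := by
  choose next hnext hagree using hsucc
  let seq : ∀ n, {c // P n c} :=
    Nat.rec ⟨_, hzero.choose_spec⟩ fun n c => ⟨next n c.1 c.2, hnext n c.1 c.2⟩
  refine ⟨fun s i => (seq (enc ⟨s, i⟩ + 1)).1 s i, fun n => ⟨(seq n).1, (seq n).2, fun k hk => ?_⟩⟩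
  induction n, (show enc k + 1 ≤ n from hk) using Nat.le_induction with
  | base => rfl
  | succ n hn ih => exact (ih hn).trans (hagree n (seq n).1 (seq n).2 k hn)

theorem IsSaturated.exists_mem_of_neBot [Countable (Σ s, X s)] {κ : Cardinal.{max u w}}
    (hsat : M.IsSaturated κ) (hκ : ℵ₀ < κ) (hA : #(Σ s, A s) < κ) (f : Filter (M.Tuple X))
    [f.NeBot] : ∃ c, ∀ D ∈ f, IsDefinable A D → c ∈ D := by
  obtain ⟨enc, henc⟩ := Countable.exists_injective_nat (Σ s, X s)
  obtain ⟨c, hc⟩ := exists_limit_of_agreeOn enc (P := fun n => AdheresOn A {k | enc k < n} f)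
    (by
      obtain ⟨c⟩ := f.nonempty_of_neBot
      refine ⟨c, fun D hD _ hsupp => ?_⟩
      obtain ⟨a, ha⟩ := f.nonempty_of_mem hD
      exact (hsupp a c fun k hk => absurd hk (Nat.not_lt_zero _)).1 ha)
    fun n c hc => by
      by_cases hn : ∃ k, enc k = n
      · obtain ⟨k, rfl⟩ := hn
        obtain ⟨e, he⟩ := hsat.exists_adheresOn_insert hκ hA hc k
        refine ⟨_, ?_, agreeOn_updateAt (lt_irrefl (enc k)) c e⟩
        convert he using 1
        ext j
        simp only [mem_ofPred_eq, mem_insert_iff, Nat.lt_succ_iff_lt_or_eq, henc.eq_iff, or_comm]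
      · push Not at hn
        refine ⟨c, ?_, fun _ _ => rfl⟩
        convert hc using 1
        ext j
        simp only [mem_ofPred_eq, Nat.lt_succ_iff_lt_or_eq, hn j, or_false]
  refine ⟨c, fun D hD hdef => ?_⟩
  obtain ⟨F, hfin, hF⟩ := hdef.exists_finite_supportedOn
  obtain ⟨n, hn⟩ := (hfin.image enc).bddAbove
  obtain ⟨c', hc', hcc'⟩ := hc (n + 1)
  have hFn : F ⊆ {k | enc k < n + 1} := fun k hk => Nat.lt_succ_of_le (hn ⟨k, hk, rfl⟩)
  exact (hF c c' (hcc'.mono hFn)).2 (hc' D hD hdef fun a a' h => hF a a' (h.mono hFn))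

end SortedLanguage.Str

namespace SortedLanguage.Str

variable {L : SortedLanguage.{u, v}} {M : Str.{u, v, w} L} {X : L.Sorts → Type x}
  {Y : L.Sorts → Type y} {A B N : M.Params}

/-! ### Type-definable sets and type spaces -/

theorem isTypeDefinable_iff {D : Set (M.Tuple X)} :
    IsTypeDefinable A D ↔ ∃ 𝒟 : Set (Set (M.Tuple X)), (∀ D' ∈ 𝒟, IsDefinable A D') ∧
      D = ⋂₀ 𝒟 := by
  constructor
  · rintro ⟨Φ, rfl⟩
    refine ⟨(fun φ => {a | RealizeOver φ a}) '' Φ, forall_mem_image.2 fun φ _ => ⟨φ, rfl⟩, ?_⟩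
    rw [sInter_image]
    exact ext fun a => ⟨fun h => mem_iInter₂.2 h, fun h φ hφ => mem_iInter₂.1 h φ hφ⟩
  · rintro ⟨𝒟, hdef, rfl⟩
    refine ⟨{φ | {a | RealizeOver φ a} ∈ 𝒟}, Subset.antisymm (fun a ha φ hφ => ha _ hφ) ?_⟩
    intro a ha D hD
    obtain ⟨φ, rfl⟩ := hdef D hD
    exact ha φ hD

theorem IsDefinable.isTypeDefinable {D : Set (M.Tuple X)} (hD : IsDefinable A D) :
    IsTypeDefinable A D :=
  isTypeDefinable_iff.2 ⟨{D}, by simpa using hD, by simp⟩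

theorem IsTypeDefinable.iInter {ι : Sort*} {D : ι → Set (M.Tuple X)}
    (hD : ∀ i, IsTypeDefinable A (D i)) : IsTypeDefinable A (⋂ i, D i) := by
  choose 𝒟 hdef heq using fun i => isTypeDefinable_iff.1 (hD i)
  refine isTypeDefinable_iff.2 ⟨⋃ i, 𝒟 i, fun D' hD' => ?_, ?_⟩
  · obtain ⟨i, hi⟩ := mem_iUnion.1 hD'
    exact hdef i D' hi
  · rw [sInter_iUnion, iInter_congr heq]

theorem IsTypeDefinable.inter {D D' : Set (M.Tuple X)} (hD : IsTypeDefinable A D)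
    (hD' : IsTypeDefinable A D') : IsTypeDefinable A (D ∩ D') := by
  rw [inter_eq_iInter]
  exact .iInter (Bool.forall_bool.2 ⟨hD', hD⟩)

theorem IsTypeDefinable.mono {D : Set (M.Tuple X)} (hD : IsTypeDefinable A D) (hAB : A ≤ B) :
    IsTypeDefinable B D :=
  isTypeDefinable_iff.2 <| (isTypeDefinable_iff.1 hD).imp fun _ h =>
    ⟨fun D' hD' => (h.1 D' hD').mono hAB, h.2⟩

theorem toType_eq_of_forall {a b : M.Tuple X}
    (h : ∀ D, IsDefinable A D → a ∈ D → b ∈ D) : toType A a = toType A b :=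
  Subtype.ext <| Subset.antisymm (fun φ ha => h _ ⟨φ, rfl⟩ ha) fun φ hb =>
    by_contra fun ha => h _ (IsDefinable.compl ⟨φ, rfl⟩) ha hb

theorem toType_mem_typesOf {D : Set (M.Tuple X)} (hD : IsTypeDefinable A D) {a : M.Tuple X} :
    toType A a ∈ typesOf A D ↔ a ∈ D := by
  obtain ⟨Φ, rfl⟩ := hD
  refine ⟨?_, mem_image_of_mem _⟩
  rintro ⟨b, hb, hba⟩ φ hφ
  exact (Set.ext_iff.1 (Subtype.ext_iff.1 hba) φ).1 (hb φ hφ)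

theorem IsDefinable.isOpen_typesOf {D : Set (M.Tuple X)} (hD : IsDefinable A D) :
    IsOpen (typesOf A D) := by
  obtain ⟨φ, rfl⟩ := id hD
  refine TopologicalSpace.isOpen_generateFrom_of_mem ⟨φ, ?_⟩
  ext ⟨_, a, rfl⟩
  exact (toType_mem_typesOf hD.isTypeDefinable).symm

theorem IsTypeDefinable.compl_typesOf {D : Set (M.Tuple X)} (hD : IsTypeDefinable A D) :
    (typesOf A D)ᶜ = typesOf A Dᶜ := by
  refine Subset.antisymm ?_ ?_
  · rintro ⟨_, a, rfl⟩ ha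
    exact ⟨a, fun haD => ha ⟨a, haD, rfl⟩, rfl⟩
  · rintro _ ⟨a, ha, rfl⟩ h
    exact ha ((toType_mem_typesOf hD).1 h)

theorem IsTypeDefinable.isClosed_typesOf {D : Set (M.Tuple X)} (hD : IsTypeDefinable A D) :
    IsClosed (typesOf A D) := by
  obtain ⟨𝒟, hdef, rfl⟩ := isTypeDefinable_iff.1 hD
  rw [← isOpen_compl_iff, hD.compl_typesOf, compl_sInter, sUnion_image, typesOf, image_iUnion₂]
  exact isOpen_biUnion fun D' hD' => (hdef D' hD').compl.isOpen_typesOf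

theorem isFSigma_iUnion {ι : Type*} [Countable ι] [Nonempty ι] {D : ι → Set (M.Tuple X)}
    (hD : ∀ i, IsTypeDefinable A (D i)) : IsFSigma A (⋃ i, D i) := by
  obtain ⟨f, hf⟩ := exists_surjective_nat ι
  refine ⟨fun n => typesOf A (D (f n)), fun n => (hD _).isClosed_typesOf, ?_⟩
  rw [typesOf, image_iUnion, ← hf.iUnion_comp]
  rfl

theorem isTypeDefinable_realisations (p : TypeSpace M X A) :
    IsTypeDefinable A p.realisations := by
  obtain ⟨_, a, rfl⟩ := p
  refine isTypeDefinable_iff.2 ⟨{D | IsDefinable A D ∧ a ∈ D}, fun D hD => hD.1, ?_⟩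
  refine Subset.antisymm (fun b hb D hD => ?_) fun b hb =>
    (toType_eq_of_forall fun D hD ha => hb D ⟨hD, ha⟩).symm
  exact (toType_mem_typesOf hD.1.isTypeDefinable).1 ⟨a, hD.2, hb.symm⟩

theorem sameType_iff_toType_eq {a b : M.Tuple X} :
    SameType a b ↔ toType M.noParams a = toType M.noParams b :=
  ⟨fun h => Subtype.ext h, congrArg Subtype.val⟩

theorem isTypeDefinable_relSet_sameType :
    IsTypeDefinable M.noParams (relSet (SameType (M := M) (X := X))) := by
  have heq : relSet (SameType (M := M) (X := X)) = ⋂ φ : M.FormulaOver M.noParams X,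
      {c | reindex (fun _ => .inl) c ∈ {a | RealizeOver φ a} ↔
        reindex (fun _ => .inr) c ∈ {a | RealizeOver φ a}} :=
    ext fun c => ⟨fun h => mem_iInter.2 (Set.ext_iff.1 h), fun h => ext (mem_iInter.1 h)⟩
  rw [heq]
  refine .iInter fun φ => IsDefinable.isTypeDefinable ?_
  have h (σ) := IsDefinable.preimage_reindex (Y := Concat X X) (A := M.noParams) ⟨φ, rfl⟩ σ
  exact (h fun _ => .inl).iff (h fun _ => .inr)

theorem IsSaturated.isClosed_image_toType_reindex [Countable (Σ s, Y s)]
    {κ : Cardinal.{max u w}} (hsat : M.IsSaturated κ) (hκ : ℵ₀ < κ) (hA : #(Σ s, A s) < κ)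
    (hBA : B ≤ A) {D : Set (M.Tuple Y)} (hD : IsTypeDefinable A D) (σ : ∀ s, X s → Y s) :
    IsClosed ((fun c => toType B (reindex σ c)) '' D) := by
  refine isClosed_of_closure_subset fun p hp => ?_
  -- A point at which this filter accumulates is in `D` and has image `p`.
  let f := Filter.comap (fun c => toType B (reindex σ c)) (nhds p) ⊓ Filter.principal D
  have : f.NeBot := by
    rw [← Filter.map_neBot_iff, Filter.push_pull', Filter.map_principal]
    exact mem_closure_iff_clusterPt.1 hp
  obtain ⟨c, hc⟩ := hsat.exists_mem_of_neBot hκ hA f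
  obtain ⟨𝒟, hdef, rfl⟩ := isTypeDefinable_iff.1 hD
  refine ⟨c, fun C hC => hc C (Filter.mem_inf_of_right fun a ha => ha C hC) (hdef C hC), ?_⟩
  obtain ⟨_, a, rfl⟩ := p
  refine (toType_eq_of_forall fun C hC ha => ?_).symm
  have hnhds : typesOf B C ∈ nhds (toType B a) := hC.isOpen_typesOf.mem_nhds ⟨a, ha, rfl⟩
  refine hc (reindex σ ⁻¹' C) ?_ ((hC.preimage_reindex σ).mono hBA)
  refine Filter.mem_of_superset (Filter.mem_inf_of_left (Filter.preimage_mem_comap hnhds)) ?_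
  exact fun c hc => (toType_mem_typesOf hC.isTypeDefinable).1 hc

/-! ### Homogeneity -/

theorem sameType_act {g : ∀ s : L.Sorts, Equiv.Perm (M.carrier s)} (hg : g ∈ M.aut)
    (a : M.Tuple X) : SameType (act g a) a :=
  ext fun φ => IsDefinable.act_mem_iff ⟨φ, rfl⟩ hg a

theorem SameType.realize_iff {a b : M.Tuple X} (h : SameType a b) (φ : L.Formula X) :
    M.Realize φ a ↔ M.Realize φ b := by
  obtain ⟨ψ, hψ⟩ := isDefinable_setOf_realize (A := M.noParams) φ
  exact (Set.ext_iff.1 hψ a).trans ((Set.ext_iff.1 h ψ).trans (Set.ext_iff.1 hψ b).symm)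

theorem IsStronglyHomogeneous.exists_act_eq [Countable (Σ s, X s)] {κ : Cardinal.{max u w}}
    (hhom : M.IsStronglyHomogeneous κ) (hκ : ℵ₀ < κ) {a b : M.Tuple X} (h : SameType a b) :
    ∃ g ∈ M.aut, act g a = b := by
  let σ (s : L.Sorts) (e : valueParams a s) : X s := e.2.choose
  have hσ (s : L.Sorts) (e : valueParams a s) : a s (σ s e) = e.1 := e.2.choose_spec
  have hb (s : L.Sorts) (i j : X s) (hij : a s i = a s j) : b s i = b s j :=
    (h.realize_iff (.equal (.var (.inl i)) (.var (.inl j)))).1 hij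
  have ha : reindex σ a = M.paramTuple (valueParams a) := funext₂ hσ
  obtain ⟨g, hg, hga⟩ := hhom _ ((mk_valueParams_le a).trans_lt hκ) (reindex σ b) fun φ => by
    rw [← ha, ← realize_map, ← realize_map, h.realize_iff]
  refine ⟨g, hg, funext₂ fun s i => ?_⟩
  exact (congrFun₂ hga s ⟨a s i, i, rfl⟩).trans (hb _ _ _ (hσ s ⟨a s i, i, rfl⟩))

/-! ### Elementary submodels -/

/-- The condition of the Tarski–Vaught test: every nonempty subset of a sort that is definable over
`N` meets `N`. -/
def IsTarskiVaught (N : M.Params) : Prop :=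
  ∀ (s : L.Sorts) (D : Set (M.Tuple (Single s))), IsDefinable N D → D.Nonempty →
    ∃ e ∈ N s, single e ∈ D

theorem IsElementarySub.isTarskiVaught (hN : M.IsElementarySub N) : IsTarskiVaught N := by
  obtain ⟨hcl, h⟩ := hN
  rintro s _ ⟨φ, rfl⟩ ⟨a, ha⟩
  rw [← single_apply a] at ha
  obtain ⟨e, he⟩ := (realize_ex φ _).1 ((h φ.ex).2 ((realize_ex φ _).2 ⟨_, ha⟩))
  let τ (t : L.Sorts) : Concat (Single s) (M.paramVars N) t → M.paramVars N t :=
    Sum.elim (single (M := M.induced N hcl) e t) id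
  have hinduced : (M.induced N hcl).Realize (φ.map τ) fun _ e => e := by
    refine (realize_map τ φ _).2 ((iff_of_eq (congrArg _ ?_)).1 he)
    funext t i
    cases i <;> rfl
  refine ⟨e.1, e.2, ?_⟩
  refine (iff_of_eq (congrArg (M.Realize φ) ?_)).1 ((realize_map τ φ _).1 ((h _).1 hinduced))
  funext t i
  rcases i with ⟨⟨rfl⟩⟩ | i <;> rfl

theorem IsTarskiVaught.funMap_mem (hN : IsTarskiVaught N) {d : List L.Sorts} {s : L.Sorts}
    (f : L.Func d s) (a : ∀ i : Fin d.length, M.carrier (d.get i)) (ha : ∀ i, a i ∈ N (d.get i)) :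
    M.funMap f a ∈ N s := by
  obtain ⟨e, heN, he⟩ := hN s {x | x s ⟨rfl⟩ = M.funMap f a}
    ⟨.equal (.var (.inl (.inl ⟨rfl⟩))) (.app f fun i => .var (.inl (.inr ⟨a i, ha i⟩))), rfl⟩
    ⟨single (M.funMap f a), rfl⟩
  rwa [show M.funMap f a = e from he.symm]

theorem isDefinable_setOf_bRealize_boundCons {l : List L.Sorts} {s : L.Sorts}
    (φ : L.BoundedFormula (M.paramVars N) (s :: l)) {b : M.Tuple (Bound l)}
    (hb : ∀ t i, b t i ∈ N t) :
    IsDefinable N {x : M.Tuple (Single s) |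
      M.BRealize (M.paramTuple N) φ (M.boundCons (x s ⟨rfl⟩) b)} := by
  let σ : ∀ t, Concat (M.paramVars N) (Bound (s :: l)) t →
      Concat (Concat (Single s) (M.paramVars N)) (Bound []) t
    | _, .inl i => .inl (.inr i)
    | _, .inr .zero => .inl (.inl ⟨rfl⟩)
    | _, .inr (.succ i) => .inl (.inr ⟨b _ i, hb _ i⟩)
  refine ⟨φ.rename σ, ext fun x => (bRealize_rename σ φ ?_).symm⟩
  funext t i
  match t, i with
  | _, .inl i => rfl
  | _, .inr .zero => rfl
  | _, .inr (.succ i) => rfl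

theorem eval_induced (hcl) (b : (M.induced N hcl).Tuple X) {s : L.Sorts} (t : L.Term X s) :
    ((M.induced N hcl).eval b t).1 = M.eval (fun s i => (b s i).1) t := by
  induction t with
  | var i => rfl
  | app f ts ih => exact congrArg (M.funMap f) (funext ih)

theorem eval_concat_induced (hcl) {l : List L.Sorts} (b : (M.induced N hcl).Tuple (Bound l))
    {s : L.Sorts} (t : L.Term (Concat (M.paramVars N) (Bound l)) s) :
    ((M.induced N hcl).eval ((M.induced N hcl).concat (fun _ e => e) b) t).1 =
      M.eval (M.concat (M.paramTuple N) fun s i => (b s i).1) t := by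
  refine (eval_induced hcl _ t).trans (congrArg (M.eval · t) ?_)
  funext s i
  cases i <;> rfl

theorem IsTarskiVaught.bRealize_induced (hN : IsTarskiVaught N) (hcl) {l : List L.Sorts}
    (φ : L.BoundedFormula (M.paramVars N) l) (b : (M.induced N hcl).Tuple (Bound l)) :
    (M.induced N hcl).BRealize (fun _ e => e) φ b ↔
      M.BRealize (M.paramTuple N) φ fun s i => (b s i).1 := by
  induction φ with
  | falsum => rfl
  | equal t₁ t₂ => simp only [BRealize, ← eval_concat_induced hcl]; exact Subtype.ext_iff
  | rel R ts => simp only [BRealize, ← eval_concat_induced hcl]; rfl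
  | imp φ ψ ihφ ihψ => exact imp_congr (ihφ b) (ihψ b)
  | all s φ ih =>
    have hcons (e : N s) : (fun t i => ((M.induced N hcl).boundCons e b t i).1) =
        M.boundCons e.1 fun t i => (b t i).1 := by
      funext t i
      cases i <;> rfl
    have ih' (e : N s) := (ih ((M.induced N hcl).boundCons e b)).trans
      (iff_of_eq (congrArg (M.BRealize (M.paramTuple N) φ) (hcons e)))
    refine ⟨fun h e => by_contra fun he => ?_, fun h e => (ih' e).2 (h e.1)⟩
    obtain ⟨e', he'N, he'⟩ := hN s _
      (isDefinable_setOf_bRealize_boundCons φ fun t i => (b t i).2).compl ⟨single e, he⟩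
    exact he' ((ih' ⟨e', he'N⟩).1 (h ⟨e', he'N⟩))

theorem IsTarskiVaught.isElementarySub (hN : IsTarskiVaught N) : M.IsElementarySub N := by
  refine ⟨fun _ _ => hN.funMap_mem, fun φ => (hN.bRealize_induced _ φ _).trans ?_⟩
  refine iff_of_eq (congrArg _ ?_)
  funext t i
  nomatch i

theorem IsTarskiVaught.exists_mem (hN : IsTarskiVaught N) {D : Set (M.Tuple X)}
    (hD : IsDefinable N D) (hne : D.Nonempty) : ∃ a ∈ D, ∀ s i, a s i ∈ N s := by
  obtain ⟨F, hfin, hF⟩ := hD.exists_finite_supportedOn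
  induction F, hfin using Set.Finite.induction_on generalizing D with
  | empty =>
    obtain ⟨a, ha⟩ := hne
    choose e heN _ using fun s (i : X s) => hN s univ isDefinable_univ ⟨single (a s i), trivial⟩
    exact ⟨e, (hF a e fun _ h => h.elim).1 ha, heN⟩
  | @insert k S _ _ ih =>
    obtain ⟨a, ha⟩ := hne
    obtain ⟨c, ⟨e, he⟩, hcN⟩ := ih (hD.setOf_exists_updateAt k)
      ⟨a, a k.1 k.2, (updateAt_eq_self a k).symm ▸ ha⟩ hF.setOf_exists_updateAt
    obtain ⟨e', he'N, he'⟩ := hN k.1 _ (hD.setOf_updateAt_mem le_rfl hcN k) ⟨single e, he⟩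
    refine ⟨_, he', fun s i => ?_⟩
    by_cases hk : ⟨s, i⟩ = k
    · subst hk
      rwa [updateAt_self]
    · exact (updateAt_of_ne c hk e').symm ▸ hcN s i

/-! ### The downward Löwenheim–Skolem theorem -/

variable (M) in
/-- An increasing sequence of parameter sets: it starts with a point of each nonempty sort, and at
each step it adds a solution of each formula in one variable over the preceding set that has one. -/
noncomputable def skolemHull : ℕ → M.Params
  | 0 => fun s => range (Classical.choice : Nonempty (M.carrier s) → M.carrier s)
  | n + 1 => fun s => skolemHull n s ∪
      range fun φ : {φ : M.FormulaOver (skolemHull n) (Single s) //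
        ∃ e, RealizeOver φ (single e)} => φ.2.choose

theorem skolemHull_mono (s : L.Sorts) : Monotone fun n => M.skolemHull n s :=
  monotone_nat_of_le_succ fun _ => subset_union_left

theorem countable_skolemHull (hL : L.IsCountable) (n : ℕ) (s : L.Sorts) :
    (M.skolemHull n s).Countable := by
  induction n generalizing s with
  | zero => exact countable_range _
  | succ n ih =>
    have := hL.1
    have (t : L.Sorts) : Countable (M.skolemHull n t) := (ih t).to_subtype
    have : Countable (M.FormulaOver (M.skolemHull n) (Single s)) := BoundedFormula.countable hL _
    exact (ih s).union (countable_range _)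

theorem IsDefinable.exists_isDefinable_skolemHull {D : Set (M.Tuple X)}
    (hD : IsDefinable (fun s => ⋃ n, M.skolemHull n s) D) :
    ∃ n, IsDefinable (M.skolemHull n) D := by
  obtain ⟨F, hfin, hF⟩ := hD.exists_finite_params
  choose n hn using fun k : Σ s, ⋃ n, M.skolemHull n s => mem_iUnion.1 k.2.2
  obtain ⟨m, hm⟩ := (hfin.image n).bddAbove
  refine ⟨m, hF _ (fun s ⟨e, _⟩ => ?_) fun k hk => skolemHull_mono k.1 (hm ⟨k, hk, rfl⟩) (hn k)⟩
  exact ⟨_, skolemHull_mono s (Nat.zero_le m) ⟨⟨e⟩, rfl⟩⟩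

theorem isTarskiVaught_iUnion_skolemHull :
    IsTarskiVaught fun s => ⋃ n, M.skolemHull n s := by
  rintro s D hD ⟨a, ha⟩
  obtain ⟨n, φ, rfl⟩ := hD.exists_isDefinable_skolemHull
  have hex : ∃ e, RealizeOver φ (single e) := ⟨a s ⟨rfl⟩, (single_apply a).symm ▸ ha⟩
  exact ⟨hex.choose, mem_iUnion.2 ⟨n + 1, .inr ⟨⟨φ, hex⟩, rfl⟩⟩, hex.choose_spec⟩

theorem exists_isElementarySub_countable (hL : L.IsCountable) :
    ∃ N : M.Params, M.IsElementarySub N ∧ Countable (Σ s, N s) := by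
  have := hL.1
  have (s : L.Sorts) : Countable (⋃ n, M.skolemHull n s) :=
    (countable_iUnion fun n => countable_skolemHull hL n s).to_subtype
  exact ⟨_, isTarskiVaught_iUnion_skolemHull.isElementarySub, inferInstance⟩

end SortedLanguage.Str

namespace SortedLanguage.Str

/-! ### Countable separating families -/

/-- Two points are `R`-related if and only if they belong to the same sets of the family `D`. A
countable family of this kind bounds the number of classes, and makes `R` smooth if its sets are
type-definable. -/
def IsSeparatedBy {α : Type x} {ι : Type y} (R : α → α → Prop) (D : ι → Set α) : Prop :=
  ∀ a b, R a b ↔ ∀ i, a ∈ D i ↔ b ∈ D i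

theorem IsSeparatedBy.equivalence {α : Type x} {ι : Type y} {R : α → α → Prop} {D : ι → Set α}
    (h : IsSeparatedBy R D) : Equivalence R where
  refl a := (h a a).2 fun _ => Iff.rfl
  symm hab := (h _ _).2 fun i => ((h _ _).1 hab i).symm
  trans hab hbc := (h _ _).2 fun i => ((h _ _).1 hab i).trans ((h _ _).1 hbc i)

theorem setOf_rel_eq {α : Type x} {R : α → α → Prop} (hR : Equivalence R) {a b : α}
    (hab : R a b) : {c | R a c} = {c | R b c} :=
  ext fun _ => ⟨hR.trans (hR.symm hab), hR.trans hab⟩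

theorem IsSeparatedBy.mk_classes_le {α : Type x} {ι : Type y} [Countable ι] {R : α → α → Prop}
    {D : ι → Set α} (h : IsSeparatedBy R D) : #(classes R) ≤ 𝔠 := by
  choose r hr using fun C : classes R => C.2
  have hinj : Function.Injective fun C : classes R => {i | r C ∈ D i} := fun C C' hCC' => by
    have hrel : R (r C) (r C') := (h _ _).2 (Set.ext_iff.1 hCC')
    rw [Subtype.ext_iff, ← hr C, ← hr C']
    exact setOf_rel_eq h.equivalence hrel
  refine lift_le_continuum.1 ((lift_mk_le_lift_mk_of_injective hinj).trans ?_)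
  rw [lift_le_continuum, mk_set, ← two_power_aleph0]
  exact power_le_power_left two_ne_zero mk_le_aleph0

section

variable {L : SortedLanguage.{u, v}} {M : Str.{u, v, w} L} {X : L.Sorts → Type x}
  {A B N : M.Params} {E R : M.Tuple X → M.Tuple X → Prop} {p₀ : TypeSpace M X M.noParams}
  {g : ∀ s : L.Sorts, Equiv.Perm (M.carrier s)}

theorem IsSeparatedBy.isSmoothRel_onTypes {ι : Type y} [Countable ι] [Nonempty ι]
    {D : ι → Set (M.Tuple X)} (h : IsSeparatedBy R D) (hD : ∀ i, IsTypeDefinable N (D i)) :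
    IsSmoothRel (onTypes N R) := by
  classical
  obtain ⟨e, he⟩ := exists_surjective_nat ι
  let f (p : TypeSpace M X N) (n : ℕ) : Bool := decide (p ∈ typesOf N (D (e n)))
  have hf (a b : M.Tuple X) : R a b ↔ f (toType N a) = f (toType N b) := by
    simp only [h a b, f, funext_iff, decide_eq_decide, toType_mem_typesOf (hD _), he.forall]
  refine ⟨ℕ → Bool, inferInstance, ⟨⟩, f, ?_, ?_⟩
  · rw [← BorelSpace.measurable_eq (α := ℕ → Bool)]
    borelize (TypeSpace M X N)
    refine measurable_pi_iff.2 fun n => measurable_to_bool ?_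
    convert (hD (e n)).isClosed_typesOf.measurableSet using 1
    exact ext fun p => decide_eq_true_iff
  · rintro ⟨_, a, rfl⟩ ⟨_, b, rfl⟩
    refine ⟨?_, fun hab => ⟨a, rfl, b, rfl, (hf a b).2 hab⟩⟩
    rintro ⟨a', ha', b', hb', hab⟩
    exact ha' ▸ hb' ▸ (hf a' b').1 hab

/-! ### Definable equivalence relations -/

theorem IsDefinable.isInvariantRel (hdef : IsDefinable M.noParams (relSet R)) :
    IsInvariantRel R :=
  fun _ hg a b => hdef.act_mem_iff hg (M.concat a b)

theorem IsDefinable.setOf_rel (hdef : IsDefinable A (relSet R)) (hAB : A ≤ B) {a : M.Tuple X}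
    (ha : ∀ s i, a s i ∈ B s) : IsDefinable B {b | R a b} :=
  (hdef.preimage_reindex fun _ => Sum.swap).fiber hAB ha

theorem IsElementarySub.isDefinable_of_mem_classes (hN : M.IsElementarySub N)
    (hE : Equivalence E) (hdef : IsDefinable N (relSet E)) (hfin : (classes E).Finite)
    {C : Set (M.Tuple X)} (hC : C ∈ classes E) : IsDefinable N C := by
  obtain ⟨a, rfl⟩ := hC
  by_contra (ha : ¬ IsDefinable N {b | E a b})
  -- The union of the classes which are definable over `N` is definable over `N`. If it is proper,
  -- then `N` has a point outside it, but the class of that point is definable over `N`.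
  let T : Set (Set (M.Tuple X)) := compl '' {C ∈ classes E | IsDefinable N C}
  have hT : IsDefinable N (⋂₀ T) :=
    .sInter ((hfin.sep _).image _) (forall_mem_image.2 fun _ hC => hC.2.compl)
  have haT : a ∈ ⋂₀ T := by
    rintro _ ⟨_, ⟨⟨c, rfl⟩, hc⟩, rfl⟩ hca
    exact ha (setOf_rel_eq hE hca ▸ hc)
  obtain ⟨b, hbT, hbN⟩ := hN.isTarskiVaught.exists_mem hT ⟨a, haT⟩
  exact hbT _ ⟨_, ⟨⟨b, rfl⟩, hdef.setOf_rel le_rfl hbN⟩, rfl⟩ (hE.refl b)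

/-! ### The relation `cutRel` -/

theorem cutRel_iff {a b : M.Tuple X} :
    cutRel E p₀ a b ↔ (a ∈ p₀.realisations → E a b) ∧ SameType a b := by
  rw [cutRel, or_comm, ← imp_iff_not_or]

theorem SameType.mem_realisations_iff {a b : M.Tuple X} (h : SameType a b) :
    a ∈ p₀.realisations ↔ b ∈ p₀.realisations := by
  simp only [TypeSpace.realisations, mem_ofPred_eq, sameType_iff_toType_eq.1 h]

theorem isInvariantRel_cutRel (hE : IsInvariantRel E) : IsInvariantRel (cutRel E p₀) :=
  fun g hg a b => by
    have hab : SameType (act g a) (act g b) ↔ SameType a b :=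
      Eq.congr (sameType_act hg a) (sameType_act hg b)
    rw [cutRel_iff, cutRel_iff, hE g hg, (sameType_act hg a).mem_realisations_iff, hab]

variable (E p₀) in
/-- A family of sets that separates `cutRel E p₀`: the sets definable without parameters, and the
intersections of the classes of `E` with the set of realisations of `p₀`. -/
def cutSeparator : M.FormulaOver M.noParams X ⊕ classes E → Set (M.Tuple X) :=
  Sum.elim (fun φ => {a | RealizeOver φ a}) fun C => p₀.realisations ∩ C

theorem isSeparatedBy_cutRel (hE : Equivalence E) :
    IsSeparatedBy (cutRel E p₀) (cutSeparator E p₀) := fun a b => by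
  rw [cutRel_iff, Sum.forall, and_comm]
  refine (and_congr_right fun hab => ⟨?_, fun h ha => ?_⟩).trans (and_congr_left' Set.ext_iff)
  · rintro h ⟨_, c, rfl⟩
    refine (and_congr_right fun ha => ?_).trans (and_congr_left' hab.mem_realisations_iff)
    exact ⟨fun hc => hE.trans hc (h ha), fun hc => hE.trans hc (hE.symm (h ha))⟩
  · exact ((h ⟨_, a, rfl⟩).1 ⟨ha, hE.refl a⟩).2

theorem isTypeDefinable_cutSeparator (hE : ∀ C ∈ classes E, IsDefinable A C) (i) :
    IsTypeDefinable A (cutSeparator E p₀ i) := by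
  have hA : M.noParams ≤ A := fun _ => empty_subset _
  rcases i with φ | C
  · exact (IsDefinable.mono ⟨φ, rfl⟩ hA).isTypeDefinable
  · exact ((isTypeDefinable_realisations p₀).mono hA).inter (hE C C.2).isTypeDefinable

theorem TypeSpace.exists_notMem_of_notMem_realisations {p : TypeSpace M X A} {a : M.Tuple X}
    (ha : a ∉ p.realisations) : ∃ φ, φ ∉ p.1 ∧ RealizeOver φ a := by
  obtain ⟨_, b, rfl⟩ := p
  by_contra! h
  refine ha (toType_eq_of_forall ?_)
  rintro _ ⟨φ, rfl⟩ hφ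
  exact by_contra fun hb => h φ hb hφ

theorem countable_formulaOver_noParams (hL : L.IsCountable) [Countable (Σ s, X s)] :
    Countable (M.FormulaOver M.noParams X) := by
  have : IsEmpty (Σ s, M.paramVars M.noParams s) := ⟨fun k => k.2.2⟩
  exact BoundedFormula.countable hL _

theorem isFSigma_relSet_cutRel (hL : L.IsCountable) [Countable (Σ s, X s)]
    (hdef : IsDefinable M.noParams (relSet E)) :
    IsFSigma M.noParams (relSet (cutRel E p₀)) := by
  have := countable_formulaOver_noParams (M := M) (X := X) hL
  let φ₀ : {φ // φ ∉ p₀.1} := ⟨.falsum, by obtain ⟨_, a, rfl⟩ := p₀; exact id⟩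
  have : Nonempty {φ // φ ∉ p₀.1} := ⟨φ₀⟩
  have heq : relSet (cutRel E p₀) = ⋃ φ : {φ // φ ∉ p₀.1},
      relSet SameType ∩ (relSet E ∪ reindex (fun _ => .inl) ⁻¹' {a | RealizeOver φ.1 a}) := by
    refine Subset.antisymm ?_ (iUnion_subset ?_)
    · rintro c ⟨hE | hp₀, hc⟩
      · exact mem_iUnion.2 ⟨φ₀, hc, .inl hE⟩
      · obtain ⟨φ, hφ, hcφ⟩ := TypeSpace.exists_notMem_of_notMem_realisations hp₀
        exact mem_iUnion.2 ⟨⟨φ, hφ⟩, hc, .inr hcφ⟩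
    · rintro ⟨φ, hφ⟩ c ⟨hc, hE | hcφ⟩
      · exact ⟨.inl hE, hc⟩
      · exact ⟨.inr fun hp₀ => hφ (hp₀ ▸ hcφ), hc⟩
  rw [heq]
  exact isFSigma_iUnion fun φ => isTypeDefinable_relSet_sameType.inter <|
    (hdef.union (IsDefinable.preimage_reindex ⟨φ.1, rfl⟩ _)).isTypeDefinable

theorem IsElementarySub.isSmoothRel_onTypes_cutRel (hN : M.IsElementarySub N)
    (hL : L.IsCountable) [Countable (Σ s, X s)] (hE : Equivalence E)
    (hdef : IsDefinable M.noParams (relSet E)) (hfin : (classes E).Finite) :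
    IsSmoothRel (onTypes N (cutRel E p₀)) := by
  have := countable_formulaOver_noParams (M := M) (X := X) hL
  have := hfin.countable.to_subtype
  have : Nonempty (M.FormulaOver M.noParams X) := ⟨.falsum⟩
  have hdefN : IsDefinable N (relSet E) := hdef.mono fun _ => empty_subset _
  exact (isSeparatedBy_cutRel hE).isSmoothRel_onTypes <|
    isTypeDefinable_cutSeparator fun C hC => hN.isDefinable_of_mem_classes hE hdefN hfin hC

/-! ### Orbitality -/

theorem IsOrbitalOn.congr {D : Set (M.Tuple X)} (hR : IsOrbitalOn R D)
    (h : ∀ a ∈ D, ∀ b ∈ D, R a b ↔ E a b) : IsOrbitalOn E D := by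
  obtain ⟨Γ, hΓ, hpres, htrans⟩ := hR
  refine ⟨Γ, hΓ, fun g hg a ha => ?_, fun a ha b hb hab => htrans a ha b hb ((h a ha b hb).2 hab)⟩
  have heq : {b ∈ D | R a b} = {b ∈ D | E a b} := ext fun b => and_congr_right (h a ha b)
  exact heq ▸ hpres g hg a ha

theorem act_image_of_forall_mem {Γ : Subgroup (∀ s : L.Sorts, Equiv.Perm (M.carrier s))}
    {D : Set (M.Tuple X)} (hD : ∀ g ∈ Γ, ∀ a ∈ D, act g a ∈ D) (hg : g ∈ Γ) : act g '' D = D := by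
  refine Subset.antisymm (image_subset_iff.2 fun a ha => hD g hg a ha) fun a ha =>
    ⟨act g⁻¹ a, hD _ (inv_mem hg) a ha, ?_⟩
  exact funext₂ fun s i => (g s).apply_symm_apply (a s i)

end

section

variable {L : SortedLanguage.{u, v}} {M : Str.{u, v, w} L} {X : L.Sorts → Type x}
  [Countable (Σ s, X s)] {E : M.Tuple X → M.Tuple X → Prop} {p₀ : TypeSpace M X M.noParams}
  {κ : Cardinal.{max u w}}

theorem IsStronglyHomogeneous.isOrbitalOn_sameType (hhom : M.IsStronglyHomogeneous κ)
    (hκ : ℵ₀ < κ) (p : TypeSpace M X M.noParams) : IsOrbitalOn SameType p.realisations := by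
  refine ⟨M.aut, le_rfl, fun g hg a _ => ?_, fun a _ b _ hab => hhom.exists_act_eq hκ hab⟩
  refine act_image_of_forall_mem (fun g hg b hb => ?_) hg
  exact ⟨(sameType_act hg b).mem_realisations_iff.2 hb.1, hb.2.trans (sameType_act hg b).symm⟩

theorem IsStronglyHomogeneous.isOrbitalOnTypes_cutRel (hhom : M.IsStronglyHomogeneous κ)
    (hκ : ℵ₀ < κ) (h : IsOrbitalOnTypes fun a b => E a b ∧ SameType a b) :
    IsOrbitalOnTypes (cutRel E p₀) := by
  refine ⟨fun a b hab => hab.2, fun p => ?_⟩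
  by_cases hp : p = p₀
  · subst hp
    refine (h.2 p).congr fun a ha b _ => ?_
    rw [cutRel_iff, imp_iff_right ha]
  · refine (hhom.isOrbitalOn_sameType hκ p).congr fun a ha b _ => ?_
    have ha₀ : a ∉ p₀.realisations := fun ha₀ => hp (ha.symm.trans ha₀)
    rw [cutRel_iff, and_iff_right fun h => absurd h ha₀]

/-! ### `cutRel` is not type-definable -/

theorem IsSaturated.exists_mem_realisations_mem_closure_typesOf (hsat : M.IsSaturated κ)
    (hκ : ℵ₀ < κ) (hE : Equivalence E) (hdef : IsDefinable M.noParams (relSet E))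
    (hfin : (classes E).Finite) (hp₀ : ¬ p₀.IsIsolated) :
    ∃ a ∈ p₀.realisations,
      p₀ ∈ closure (typesOf M.noParams ({b | E a b} \ p₀.realisations)) := by
  have hcover : {p₀}ᶜ ⊆ ⋃ C ∈ classes E, typesOf M.noParams (C \ p₀.realisations) := by
    rintro ⟨_, a, rfl⟩ ha
    exact mem_biUnion ⟨a, rfl⟩ ⟨a, ⟨hE.refl a, ha⟩, rfl⟩
  have hlim := closure_mono hcover (dense_compl_singleton_iff_not_open.2 hp₀ p₀)
  rw [hfin.closure_biUnion] at hlim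
  obtain ⟨_, ⟨c, rfl⟩, hc⟩ := mem_iUnion₂.1 hlim
  have hdefc : IsDefinable (valueParams c) {b | E c b} :=
    hdef.setOf_rel (fun _ => empty_subset _) fun _ i => mem_range_self i
  have hclosed : IsClosed (typesOf M.noParams {b | E c b}) :=
    hsat.isClosed_image_toType_reindex hκ ((mk_valueParams_le c).trans_lt hκ)
      (fun _ => empty_subset _) hdefc.isTypeDefinable fun _ => id
  obtain ⟨a, hca, ha⟩ := closure_minimal (image_mono sdiff_subset) hclosed hc
  exact ⟨a, ha, setOf_rel_eq hE hca ▸ hc⟩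

theorem IsSaturated.not_isTypeDefinable_cutRel (hsat : M.IsSaturated κ)
    (hhom : M.IsStronglyHomogeneous κ) (hκ : ℵ₀ < κ) (hE : Equivalence E)
    (hdef : IsDefinable M.noParams (relSet E)) (hfin : (classes E).Finite)
    (hp₀ : ¬ p₀.IsIsolated) (hsplit : ¬ ∃ C ∈ classes E, p₀.realisations ⊆ C) :
    ¬ IsTypeDefinable M.noParams (relSet (cutRel E p₀)) := by
  intro hcut
  obtain ⟨a, ha, hlim⟩ :=
    hsat.exists_mem_realisations_mem_closure_typesOf hκ hE hdef hfin hp₀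
  obtain ⟨a', ha', haa'⟩ : ∃ a' ∈ p₀.realisations, ¬ E a a' := by
    by_contra! h
    exact hsplit ⟨_, ⟨a, rfl⟩, h⟩
  obtain ⟨g, hg, rfl⟩ := hhom.exists_act_eq hκ (sameType_iff_toType_eq.2 (ha.trans ha'.symm))
  have hmoved {b : M.Tuple X} (hab : E a b) : ¬ E b (act g b) := fun h =>
    haa' (hE.trans (hE.trans hab h) (hE.symm ((hdef.isInvariantRel g hg a b).2 hab)))
  have hclosed := hsat.isClosed_image_toType_reindex hκ
    (by simpa using aleph0_pos.trans hκ) le_rfl (hcut.inter hdef.compl.isTypeDefinable)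
    fun _ => Sum.inl
  have hsub : typesOf M.noParams ({b | E a b} \ p₀.realisations) ⊆
      (fun c => toType M.noParams (reindex (fun _ => Sum.inl) c)) ''
        (relSet (cutRel E p₀) ∩ (relSet E)ᶜ) := by
    rintro _ ⟨b, ⟨hab, hb⟩, rfl⟩
    exact ⟨M.concat b (act g b), ⟨⟨.inr hb, (sameType_act hg b).symm⟩, hmoved hab⟩, rfl⟩
  obtain ⟨c, ⟨hc, hcE⟩, hcp₀⟩ := closure_minimal hsub hclosed hlim
  exact hcE ((cutRel_iff.1 hc).1 hcp₀)

end

/-! ### Counting classes -/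

section

variable {L : SortedLanguage.{u, v}} {M : Str.{u, v, w} L} {κ : Cardinal.{max u w}}

theorem mk_iUnion_params_lt {ι : Type (max u w)} (hκ : ℵ₀ < κ) (hι : #ι < κ) {A : ι → M.Params}
    (hA : ∀ i, #(Σ s, A i s) ≤ ℵ₀) : #(Σ s, ⋃ i, A i s) < κ := by
  have hsurj : Function.Surjective (fun k => ⟨k.2.1, k.2.2.1, mem_iUnion_of_mem k.1 k.2.2.2⟩ :
      (Σ i, Σ s, A i s) → Σ s, ⋃ i, A i s) := by
    rintro ⟨s, e, he⟩
    obtain ⟨i, hi⟩ := mem_iUnion.1 he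
    exact ⟨⟨i, s, e, hi⟩, rfl⟩
  refine (mk_le_of_surjective hsurj).trans_lt ?_
  rw [mk_sigma]
  refine (sum_le_sum _ _ hA).trans_lt ?_
  rw [sum_const']
  exact mul_lt_of_lt hκ.le hι hκ

variable {X : L.Sorts → Type} [Countable (Σ s, X s)] {E : M.Tuple X → M.Tuple X → Prop}

theorem IsSaturated.finite_classes (hsat : M.IsSaturated κ) (hκ : ℵ₀ < κ) (hE : Equivalence E)
    (hdef : IsDefinable M.noParams (relSet E)) (hbdd : #(classes E) < κ) :
    (classes E).Finite := by
  by_contra hinf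
  have := infinite_coe_iff.2 hinf
  choose r hr using fun C : classes E => C.2
  -- Every class is definable over `A`, so a point realising the filter of the sets that
  -- contain all but finitely many classes would lie in no class.
  let A : M.Params := fun s => ⋃ C, valueParams (r C) s
  have hA : #(Σ s, A s) < κ := mk_iUnion_params_lt hκ hbdd fun C => mk_valueParams_le (r C)
  let classOf (a : M.Tuple X) : classes E := ⟨{b | E a b}, a, rfl⟩
  have hsurj : Function.Surjective classOf := fun ⟨_, a, ha⟩ => ⟨a, Subtype.ext ha⟩
  have := (Filter.cofinite_neBot (α := classes E)).comap_of_surj hsurj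
  obtain ⟨a, ha⟩ := hsat.exists_mem_of_neBot hκ hA (.comap classOf .cofinite)
  have hclass : IsDefinable A {b | E a b} := by
    have hrep : {b | E (r (classOf a)) b} = {b | E a b} := hr (classOf a)
    rw [← hrep]
    exact hdef.setOf_rel (fun _ => empty_subset _) fun _ i =>
      mem_iUnion_of_mem _ (mem_range_self i)
  refine ha {b | E a b}ᶜ ?_ hclass.compl (hE.refl a)
  refine ⟨{classOf a}ᶜ, (finite_singleton _).compl_mem_cofinite, fun b hb hab => hb ?_⟩
  exact Subtype.ext (setOf_rel_eq hE hab).symm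

theorem mk_classes_cutRel_lt (hL : L.IsCountable) (hκ : 𝔠 < κ) (hE : Equivalence E)
    (hfin : (classes E).Finite) {p₀ : TypeSpace M X M.noParams} :
    #(classes (cutRel E p₀)) < κ := by
  have := countable_formulaOver_noParams (M := M) (X := X) hL
  have := hfin.countable.to_subtype
  exact (isSeparatedBy_cutRel hE).mk_classes_le.trans_lt hκ

end

end SortedLanguage.Str

theorem mainTheorem8 (L : SortedLanguage.{u, v}) (hL : L.IsCountable)
    (M : SortedLanguage.Str.{u, v, w} L) (κ : Cardinal.{max u w}) (hκ : Cardinal.continuum < κ)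
    (hsat : M.IsSaturated κ) (hhom : M.IsStronglyHomogeneous κ)
    (X : L.Sorts → Type) (hX : Countable (Σ s, X s))
    (E : M.Tuple X → M.Tuple X → Prop) (hE : Equivalence E)
    (hdef : IsDefinable M.noParams (relSet E))
    (hbdd : Cardinal.mk (classes E) < κ)
    (p₀ : TypeSpace M X M.noParams) (hp₀ : ¬ p₀.IsIsolated)
    (hsplit : ¬ ∃ C ∈ classes E, p₀.realisations ⊆ C) :
    (classes E).Finite ∧
    Equivalence (cutRel E p₀) ∧
    IsInvariantRel (cutRel E p₀) ∧
    Cardinal.mk (classes (cutRel E p₀)) < κ ∧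
    IsFSigma M.noParams (relSet (cutRel E p₀)) ∧
    IsSmooth (cutRel E p₀) ∧
    ¬ IsTypeDefinable M.noParams (relSet (cutRel E p₀)) ∧
    (IsOrbitalOnTypes (fun a b => E a b ∧ SameType a b) → IsOrbitalOnTypes (cutRel E p₀)) := by
  have hκ₀ : ℵ₀ < κ := aleph0_lt_continuum.trans hκ
  have hfin : (classes E).Finite := hsat.finite_classes hκ₀ hE hdef hbdd
  refine ⟨hfin, ?equivalence, ?invariant, ?bounded, ?fSigma, ?smooth, ?notTypeDefinable, ?orbital⟩
  case equivalence => exact (isSeparatedBy_cutRel hE).equivalence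
  case invariant => exact isInvariantRel_cutRel hdef.isInvariantRel
  case bounded => exact mk_classes_cutRel_lt hL hκ hE hfin
  case fSigma => exact isFSigma_relSet_cutRel hL hdef
  case smooth =>
    exact ⟨exists_isElementarySub_countable hL, fun N hN _ =>
      hN.isSmoothRel_onTypes_cutRel hL hE hdef hfin⟩
  case notTypeDefinable =>
    exact hsat.not_isTypeDefinable_cutRel hhom hκ₀ hE hdef hfin hp₀ hsplit
  case orbital => exact hhom.isOrbitalOnTypes_cutRel hκ₀
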